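/- Let $f:\mathbb{R}\to\mathbb{R}$ be real analytic, and let $\mathcal{M}_f=(\mathbb{R}^4,g_f)$, where $\mathbb{R}^4$ has coordinates $(x,y,\tilde x,\tilde y)$ and $g_f$ is the pseudo-Riemannian metric of signature $(2,2)$ whose non-zero components, up to symmetry, are $$g_f(\partial_x,\partial_x)=-2f(y),\qquad g_f(\partial_x,\partial_{\tilde x})=g_f(\partial_y,\partial_{\tilde y})=1.$$ Let $\mathfrak{g}_f$ be the Lie algebra of Killing vector fields of $\mathcal{M}_f$, i.e. of the smooth vector fields $X$ on $\mathbb{R}^4$ with $L_Xg_f=0$. Put $F(y)=\int_0^yf(t)\,dt$ and $$X_1=\partial_x,\quad X_2=\partial_{\tilde x},\quad X_3=\partial_{\tilde y},\quad X_4=-y\,\partial_{\tilde x}+x\,\partial_{\tilde y},\quad X_5=y\,\partial_x+2F(y)\,\partial_{\tilde x}-\tilde x\,\partial_{\tilde y}.$$ 1. If $f''=0$ identically, then $\dim\mathfrak{g}_f=10$. A basis consists of $X_1,\dots,X_5$, the fields $X_6,X_7,X_8$ of (2) with $c=0$, and, with $d=f'(0)$, $u=\tilde x-xf(y)$, $v=\tilde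 y+\tfrac12dx^2$, $$X_9=y\,\partial_y+d\,xy\,\partial_{\tilde x}-v\,\partial_{\tilde y},\qquad X_{10}=-v\,\partial_x+u\,\partial_y+(d\,xu-f(y)v)\,\partial_{\tilde x}+d\,xv\,\partial_{\tilde y}.$$ 2. If $f''=c$ for a constant $c\neq0$, then $\dim\mathfrak{g}_f=8$. A basis consists of $X_1,\dots,X_5$ and $$X_6=\partial_y+xf'(y)\,\partial_{\tilde x}-\tfrac c2x^2\,\partial_{\tilde y},\qquad X_7=x\,\partial_y+\left(\tfrac12x^2f'(y)-\tilde y\right)\partial_{\tilde x}-\tfrac c6x^3\,\partial_{\tilde y},$$ $$X_8=x\,\partial_x-y\,\partial_y+\left(x(2f(y)-yf'(y))-\tilde x\right)\partial_{\tilde x}+\left(\tilde y-\tfrac12f'(0)x^2\right)\partial_{\tilde y}.$$ 3. If $f''(y)=ae^{\lambda y}$ for all $y$, with real $a\neq0$ and $\lambda\neq0$, then $\dim\mathfrak{g}_f=6$. A basis consists of $X_1,\dots,X_5$ and $$-\tfrac\lambda2x\,\partial_x+\partial_y+\left(x(f'(y)-\lambda f(y))+\tfrac\lambda2\tilde x\right)\partial_{\tilde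 x}-\tfrac12\left(a-\lambda f'(0)\right)x^2\,\partial_{\tilde y}.$$ 4. If $f''(y)=a(y+b)^n$ for all $y$, with real $a\neq0$, $b\in\mathbb{R}$ and an integer $n\geq1$, then $\dim\mathfrak{g}_f=6$. A basis consists of $X_1,\dots,X_5$ and, with $s=\frac{2}{n+2}$, $$x\,\partial_x-s(y+b)\,\partial_y+\left(x\bigl(2f(y)-s(y+b)f'(y)\bigr)-\tilde x\right)\partial_{\tilde x}+\left(s\tilde y-\tfrac{n+1}{n+2}f'(-b)x^2\right)\partial_{\tilde y}.$$ 5. If $f''$ is not of the form $ae^{\lambda y}$ for any $a,\lambda\in\mathbb{R}$ and not of the form $a(y+b)^n$ for any $a,b\in\mathbb{R}$ and any integer $n\geq0$, then $\dim\mathfrak{g}_f=5$, and $X_1,\dots,X_5$ form a basis. -/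

import Mathlib

open scoped ContDiff

set_option maxSynthPendingDepth 3

/-- Smooth vector fields on a real normed space `E`. -/
def SmoothVectorField (E : Type*) [NormedAddCommGroup E] [NormedSpace ℝ E] :
    Submodule ℝ (E → E) where
  carrier := {X | ContDiff ℝ ∞ X}
  add_mem' {X Y} (hX : ContDiff ℝ ∞ X) (hY : ContDiff ℝ ∞ Y) := hX.add hY
  zero_mem' := show ContDiff ℝ ∞ (0 : E → E) from contDiff_zero_fun
  smul_mem' _ X (hX : ContDiff ℝ ∞ X) := contDiff_const.smul hX

namespace SmoothVectorField

variable {E : Type*} [NormedAddCommGroup E] [NormedSpace ℝ E]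

theorem contDiff (X : SmoothVectorField E) : ContDiff ℝ ∞ (X : E → E) := X.2

theorem differentiableAt (X : SmoothVectorField E) (p : E) :
    DifferentiableAt ℝ (X : E → E) p :=
  (contDiff X).differentiable (by simp) p

/-- The Lie bracket `[X, Y](p) = DY_p (X p) - DX_p (Y p)` of smooth vector fields. -/
noncomputable instance : Bracket (SmoothVectorField E) (SmoothVectorField E) where
  bracket X Y := ⟨VectorField.lieBracket ℝ (X : E → E) (Y : E → E),
    ContDiff.lieBracket_vectorField (m := ∞) (n := ∞) (contDiff X) (contDiff Y) le_rfl⟩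

theorem coe_bracket (X Y : SmoothVectorField E) :
    ((⁅X, Y⁆ : SmoothVectorField E) : E → E)
      = VectorField.lieBracket ℝ (X : E → E) (Y : E → E) := rfl

noncomputable instance : LieRing (SmoothVectorField E) where
  add_lie X Y Z := Subtype.ext <| funext fun p =>
    VectorField.lieBracket_add_left (differentiableAt X p) (differentiableAt Y p)
  lie_add X Y Z := Subtype.ext <| funext fun p =>
    VectorField.lieBracket_add_right (differentiableAt Y p) (differentiableAt Z p)
  lie_self X := Subtype.ext VectorField.lieBracket_self
  leibniz_lie X Y Z := Subtype.ext <| funext fun p =>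
    VectorField.leibniz_identity_lieBracket (n := ∞)
      (by rw [minSmoothness_of_isRCLikeNormedField]; exact WithTop.coe_le_coe.2 le_top)
      (contDiff X).contDiffAt (contDiff Y).contDiffAt (contDiff Z).contDiffAt

noncomputable instance : LieAlgebra ℝ (SmoothVectorField E) where
  lie_smul _ _ Y := Subtype.ext <| funext fun p =>
    VectorField.lieBracket_const_smul_right (differentiableAt Y p)

end SmoothVectorField

/-- A smooth pseudo-Riemannian metric on the vector space `E`, regarded as a manifold whose
tangent space at every point is `E`. -/
structure PseudoRiemannianMetric (E : Type*) [NormedAddCommGroup E] [NormedSpace ℝ E] where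
  /-- the metric tensor at a point -/
  val : E → E →L[ℝ] E →L[ℝ] ℝ
  contDiff : ContDiff ℝ ∞ val
  symm : ∀ p u v, val p u v = val p v u
  nondegenerate : ∀ p u, (∀ v, val p u v = 0) → u = 0

namespace PseudoRiemannianMetric

variable {E : Type*} [NormedAddCommGroup E] [NormedSpace ℝ E]

/-- The Lie derivative `(L_X g)_p(u, v)` of the metric `g` along the vector field `X`; in linear
coordinates it is `X^k ∂_k g_{ij} + g_{kj} ∂_i X^k + g_{ik} ∂_j X^k`. -/
noncomputable def lieDeriv (g : PseudoRiemannianMetric E) (X : E → E) (p u v : E) : ℝ :=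
  fderiv ℝ g.val p (X p) u v + g.val p (fderiv ℝ X p u) v + g.val p u (fderiv ℝ X p v)

/-- `X` is a Killing vector field of `g` if `L_X g = 0`. -/
def IsKilling (g : PseudoRiemannianMetric E) (X : E → E) : Prop :=
  ∀ p u v, g.lieDeriv X p u v = 0

theorem fderiv_lieBracket_apply (X Y : SmoothVectorField E) (p u : E) :
    fderiv ℝ (VectorField.lieBracket ℝ (X : E → E) (Y : E → E)) p u =
      fderiv ℝ (fderiv ℝ (Y : E → E)) p u (X.1 p) + fderiv ℝ Y.1 p (fderiv ℝ X.1 p u)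
      - (fderiv ℝ (fderiv ℝ (X : E → E)) p u (Y.1 p) + fderiv ℝ X.1 p (fderiv ℝ Y.1 p u)) := by
  have h1 (Z : SmoothVectorField E) : DifferentiableAt ℝ (fderiv ℝ (Z : E → E)) p :=
    (ContDiff.fderiv_right (m := ∞) (SmoothVectorField.contDiff Z) le_rfl).differentiable (by simp) p
  rw [VectorField.lieBracket_eq, fderiv_fun_sub ((h1 Y).clm_apply (SmoothVectorField.differentiableAt X p))
    ((h1 X).clm_apply (SmoothVectorField.differentiableAt Y p)),
    fderiv_clm_apply (h1 Y) (SmoothVectorField.differentiableAt X p),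
    fderiv_clm_apply (h1 X) (SmoothVectorField.differentiableAt Y p)]
  simp
  abel

theorem isKilling_fderiv (g : PseudoRiemannianMetric E) (X : SmoothVectorField E)
    (hX : g.IsKilling X) (p w u v : E) :
    fderiv ℝ (fderiv ℝ g.val) p w (X.1 p) u v + fderiv ℝ g.val p (fderiv ℝ X.1 p w) u v
      + (fderiv ℝ g.val p w (fderiv ℝ X.1 p u) v
        + g.val p (fderiv ℝ (fderiv ℝ X.1) p w u) v)
      + (fderiv ℝ g.val p w u (fderiv ℝ X.1 p v)
        + g.val p u (fderiv ℝ (fderiv ℝ X.1) p w v)) = 0 := by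
  have hX1 : HasFDerivAt X.1 (fderiv ℝ X.1 p) p := (SmoothVectorField.differentiableAt X p).hasFDerivAt
  have hX2 : HasFDerivAt (fderiv ℝ X.1) (fderiv ℝ (fderiv ℝ X.1) p) p :=
    ((ContDiff.fderiv_right (m := ∞) (SmoothVectorField.contDiff X) le_rfl).differentiable (by simp) p).hasFDerivAt
  have hg1 : HasFDerivAt g.val (fderiv ℝ g.val p) p :=
    (g.contDiff.differentiable (by simp) p).hasFDerivAt
  have hg2 : HasFDerivAt (fderiv ℝ g.val) (fderiv ℝ (fderiv ℝ g.val) p) p :=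
    ((ContDiff.fderiv_right (m := ∞) g.contDiff le_rfl).differentiable (by simp) p).hasFDerivAt
  have hc (u : E) : HasFDerivAt (fun _ : E => u) (0 : E →L[ℝ] E) p := hasFDerivAt_const u p
  have h := (((hg2.clm_apply hX1).clm_apply (hc u)).clm_apply (hc v)).add
    (((hg1.clm_apply (hX2.clm_apply (hc u))).clm_apply (hc v))) |>.add
    ((hg1.clm_apply (hc u)).clm_apply (hX2.clm_apply (hc v)))
  have h0 : HasFDerivAt (fun q => g.lieDeriv X.1 q u v) (0 : E →L[ℝ] ℝ) p := by
    have : (fun q => g.lieDeriv X.1 q u v) = fun _ => 0 := funext fun q => hX q u v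
    rw [this]; exact hasFDerivAt_const _ _
  have h3 := congrArg (fun L : E →L[ℝ] ℝ => L w) (h.unique h0)
  simp at h3
  linarith

theorem IsKilling.lieBracket (g : PseudoRiemannianMetric E) (X Y : SmoothVectorField E)
    (hX : g.IsKilling X) (hY : g.IsKilling Y) :
    g.IsKilling (VectorField.lieBracket ℝ (X : E → E) (Y : E → E)) := by
  intro p u v
  have hs {F : Type _} [NormedAddCommGroup F] [NormedSpace ℝ F] {φ : E → F}
      (hφ : ContDiff ℝ ∞ φ) (a b : E) :
      fderiv ℝ (fderiv ℝ φ) p a b = fderiv ℝ (fderiv ℝ φ) p b a :=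
    (hφ.contDiffAt.isSymmSndFDerivAt
      (by rw [minSmoothness_of_isRCLikeNormedField]; exact WithTop.coe_le_coe.2 le_top)) a b
  have e1 := isKilling_fderiv g X hX p (Y.1 p) u v
  have e2 := isKilling_fderiv g Y hY p (X.1 p) u v
  have s1 := hs g.contDiff (X.1 p) (Y.1 p)
  have a1 := hX p (fderiv ℝ Y.1 p u) v
  have a2 := hX p u (fderiv ℝ Y.1 p v)
  have a3 := hY p (fderiv ℝ X.1 p u) v
  have a4 := hY p u (fderiv ℝ X.1 p v)
  simp only [lieDeriv] at a1 a2 a3 a4 ⊢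
  rw [fderiv_lieBracket_apply, fderiv_lieBracket_apply, hs (SmoothVectorField.contDiff Y) u, hs (SmoothVectorField.contDiff X) u, hs (SmoothVectorField.contDiff Y) v, hs (SmoothVectorField.contDiff X) v]
  rw [s1] at e2
  simp only [VectorField.lieBracket, map_sub, map_add, _root_.sub_apply,
    _root_.add_apply] at *
  linarith

/-- The Lie algebra of all smooth Killing vector fields of `g`. -/
noncomputable def killingAlgebra (g : PseudoRiemannianMetric E) :
    LieSubalgebra ℝ (SmoothVectorField E) where
  carrier := {X | g.IsKilling X}
  add_mem' := by
    intro X Y hX hY p u v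
    have h1 := hX p u v
    have h2 := hY p u v
    simp only [lieDeriv, Submodule.coe_add, Pi.add_apply,
      fderiv_add (SmoothVectorField.differentiableAt X p) (SmoothVectorField.differentiableAt Y p), map_add,
      _root_.add_apply] at *
    linarith
  zero_mem' := by
    intro p u v
    simp [lieDeriv]
  smul_mem' := by
    intro c X hX p u v
    have h1 := hX p u v
    simp only [lieDeriv, Submodule.coe_smul, Pi.smul_apply,
      fderiv_const_smul (SmoothVectorField.differentiableAt X p), map_smul,
      _root_.smul_apply, smul_eq_mul] at *
    linear_combination c * h1
  lie_mem' := by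
    intro X Y hX hY
    exact IsKilling.lieBracket g X Y hX hY

/-- The vector fields `v 0, …, v (n-1)` form a basis of the Lie algebra of Killing vector fields. -/
def IsKillingBasis (g : PseudoRiemannianMetric E) {n : ℕ} (v : Fin n → E → E) : Prop :=
  ∃ b : Module.Basis (Fin n) ℝ g.killingAlgebra,
    ∀ i, ((b i : SmoothVectorField E) : E → E) = v i

end PseudoRiemannianMetric

/-- The space `ℝ⁴`; the coordinates `p 0, p 1, p 2, p 3` of a point `p` are
`x, y, x̃, ỹ` in this order. -/
abbrev R4 : Type := Fin 4 → ℝ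

/-- The `(0,2)`-tensor `dxⁱ ⊗ dxʲ` on `ℝ⁴`. -/
noncomputable def dxTensor (i j : Fin 4) : R4 →L[ℝ] R4 →L[ℝ] ℝ :=
  (ContinuousLinearMap.proj (R := ℝ) (φ := fun _ : Fin 4 => ℝ) i).smulRight
    (ContinuousLinearMap.proj (R := ℝ) (φ := fun _ : Fin 4 => ℝ) j)

@[simp] theorem dxTensor_apply (i j : Fin 4) (u v : R4) : dxTensor i j u v = u i * v j := by
  simp [dxTensor]

/-- The metric `g_f` on `ℝ⁴`, whose non-zero components up to symmetry are
`g_f(∂_x, ∂_x) = -2 f(y)` and `g_f(∂_x, ∂_x̃) = g_f(∂_y, ∂_ỹ) = 1`. -/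
noncomputable def planeWave (f : ℝ → ℝ) (hf : AnalyticOnNhd ℝ f Set.univ) :
    PseudoRiemannianMetric R4 where
  val p := (-2 * f (p 1)) • dxTensor 0 0 + (dxTensor 0 2 + dxTensor 2 0)
    + (dxTensor 1 3 + dxTensor 3 1)
  contDiff := by
    have h : ContDiff ℝ ∞ f :=
      contDiff_iff_contDiffAt.2 fun y => (hf y (Set.mem_univ y)).contDiffAt
    have h1 : ContDiff ℝ ∞ (fun p : R4 => f (p 1)) := h.comp (contDiff_apply ℝ ℝ 1)
    exact (((contDiff_const.mul h1).smul contDiff_const).add contDiff_const).add contDiff_const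
  symm := by
    intro p u v
    simp
    ring
  nondegenerate := by
    intro p u h
    have h0 := h (Pi.single 0 1)
    have h1 := h (Pi.single 1 1)
    have h2 := h (Pi.single 2 1)
    have h3 := h (Pi.single 3 1)
    simp at h0 h1 h2 h3
    ext i
    fin_cases i <;> simp_all

namespace PlaneWaveKilling

/-! Explicit vector fields on `ℝ⁴`, written in the frame `∂_x, ∂_y, ∂_x̃, ∂_ỹ`. -/

/-- `∂_x` -/
def X1 (_ : R4) : R4 := ![1, 0, 0, 0]

/-- `∂_x̃` -/
def X2 (_ : R4) : R4 := ![0, 0, 1, 0]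

/-- `∂_ỹ` -/
def X3 (_ : R4) : R4 := ![0, 0, 0, 1]

/-- `-y ∂_x̃ + x ∂_ỹ` -/
def X4 (p : R4) : R4 := ![0, 0, -p 1, p 0]

/-- `y ∂_x + 2 F(y) ∂_x̃ - x̃ ∂_ỹ`, where `F' = f` and `F(0) = 0` -/
noncomputable def X5 (f : ℝ → ℝ) (p : R4) : R4 :=
  ![p 1, 0, 2 * ∫ t in (0 : ℝ)..p 1, f t, -p 2]

/-- `∂_y + x f'(y) ∂_x̃ - (c/2) x² ∂_ỹ`, for `f'' = c` -/
noncomputable def X6const (f : ℝ → ℝ) (c : ℝ) (p : R4) : R4 :=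
  ![0, 1, p 0 * deriv f (p 1), -(c / 2) * p 0 ^ 2]

/-- `x ∂_y + (x² f'(y) / 2 - ỹ) ∂_x̃ - (c/6) x³ ∂_ỹ`, for `f'' = c` -/
noncomputable def X7const (f : ℝ → ℝ) (c : ℝ) (p : R4) : R4 :=
  ![0, p 0, p 0 ^ 2 * deriv f (p 1) / 2 - p 3, -(c / 6) * p 0 ^ 3]

/-- `x ∂_x - y ∂_y + (x (2 f(y) - y f'(y)) - x̃) ∂_x̃ + (ỹ - f'(0) x² / 2) ∂_ỹ`,
for `f''` constant -/
noncomputable def X8const (f : ℝ → ℝ) (p : R4) : R4 :=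
  ![p 0, -p 1, p 0 * (2 * f (p 1) - p 1 * deriv f (p 1)) - p 2, p 3 - deriv f 0 * p 0 ^ 2 / 2]

/-- `y ∂_y + x y f'(0) ∂_x̃ - (ỹ + f'(0) x² / 2) ∂_ỹ`, for `f'' = 0` -/
noncomputable def X9flat (f : ℝ → ℝ) (p : R4) : R4 :=
  ![0, p 1, p 0 * p 1 * deriv f 0, -(p 3 + deriv f 0 * p 0 ^ 2 / 2)]

/-- With `u = x̃ - x f(y)` and `v = ỹ + f'(0) x² / 2`, the field
`-v ∂_x + u ∂_y + (f'(0) x u - f(y) v) ∂_x̃ + f'(0) x v ∂_ỹ`, for `f'' = 0` -/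
noncomputable def X10flat (f : ℝ → ℝ) (p : R4) : R4 :=
  let u := p 2 - p 0 * f (p 1)
  let v := p 3 + deriv f 0 * p 0 ^ 2 / 2
  ![-v, u, deriv f 0 * p 0 * u - f (p 1) * v, deriv f 0 * p 0 * v]

/-- `-(λ/2) x ∂_x + ∂_y + (x (f'(y) - λ f(y)) + (λ/2) x̃) ∂_x̃ - ((a - λ f'(0)) / 2) x² ∂_ỹ`,
for `f''(y) = a e^{λ y}`; here `a - λ f'(0)` is the constant value of `f'' - λ f'` -/
noncomputable def X6exp (f : ℝ → ℝ) (a l : ℝ) (p : R4) : R4 :=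
  ![-(l / 2) * p 0, 1, p 0 * (deriv f (p 1) - l * f (p 1)) + l / 2 * p 2,
    -((a - l * deriv f 0) / 2) * p 0 ^ 2]

/-- With `s = 2 / (n + 2)`, the field
`x ∂_x - s (y+b) ∂_y + (x (2 f(y) - s (y+b) f'(y)) - x̃) ∂_x̃
  + (s ỹ - ((n+1)/(n+2)) f'(-b) x²) ∂_ỹ`, for `f''(y) = a (y+b)^n` -/
noncomputable def X6pow (f : ℝ → ℝ) (b : ℝ) (n : ℕ) (p : R4) : R4 :=
  let s : ℝ := 2 / (n + 2)
  ![p 0, -s * (p 1 + b), p 0 * (2 * f (p 1) - s * (p 1 + b) * deriv f (p 1)) - p 2,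
    s * p 3 - (n + 1) / (n + 2) * deriv f (-b) * p 0 ^ 2]

end PlaneWaveKilling

open PlaneWaveKilling

/-! Write a Killing field as (A, B, C, D) in the coordinates x, y, p = x̃, q = ỹ, with subscripts
for partial derivatives. The condition L_X g = 0 is a system of ten linear first-order equations
(`KillingSystem`). Equating mixed second derivatives shows that the system is of finite type: ten
numbers at the origin determine the field (`KillingSystem.eq_zero`), so the dimension is at most 10.

The same cross-differentiation leaves three compatibility conditions: f'' B_p = 0, f''' B + 2 f''
(B_y + A_x) = 0, and, when B_p = 0, f''' B_x = 0. On the y-axis B is affine and A_x, B_y are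
constant, so the second becomes f''' (β + κ y) + 2 σ f'' = 0 with β = B(0), κ = B_y(0), σ = κ +
A_x(0).

If f'' = 0 nothing is lost. If f'' is a nonzero constant, B_p and σ vanish, which leaves 8.
Otherwise B_p = B_x = 0, and the last equation is an ODE for f'': for κ = 0 and β ≠ 0 its solutions
are exponentials, and for κ ≠ 0 it is an Euler equation, whose solutions analytic across the
singular point are natural powers (`exists_eq_pow_of_euler`). In these two families one parameter
survives; for any other f'' all of β, κ, σ vanish.

Conversely, the explicit fields are checked to be Killing, and suitable linear functionals on the
jet at the origin are dual to them (`jet`). Independence and spanning then both follow from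
`isKillingBasis_of_dual`. -/

namespace PseudoRiemannianMetric

variable {E : Type*} [NormedAddCommGroup E] [NormedSpace ℝ E]

/-- Killing fields that are dual to linear functionals separating Killing fields form a basis. -/
theorem isKillingBasis_of_dual (g : PseudoRiemannianMetric E) {n : ℕ} (v : Fin n → E → E)
    (hs : ∀ i, ContDiff ℝ ∞ (v i)) (hk : ∀ i, g.IsKilling (v i))
    (φ : Fin n → SmoothVectorField E →ₗ[ℝ] ℝ)
    (hφ : ∀ i j, φ i ⟨v j, hs j⟩ = if i = j then 1 else 0)
    (h0 : ∀ X : SmoothVectorField E, g.IsKilling X → (∀ i, φ i X = 0) → X = 0) :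
    Module.finrank ℝ g.killingAlgebra = n ∧ g.IsKillingBasis v := by
  let w : Fin n → g.killingAlgebra := fun i => ⟨⟨v i, hs i⟩, hk i⟩
  let ψ : Fin n → g.killingAlgebra →ₗ[ℝ] ℝ := fun i =>
    (φ i).comp g.killingAlgebra.toSubmodule.subtype
  have hψ : ∀ i j, ψ i (w j) = if i = j then 1 else 0 := hφ
  have hli : LinearIndependent ℝ w := by
    rw [Fintype.linearIndependent_iff]
    intro c hc i
    have := congrArg (ψ i) hc
    simpa [map_sum, hψ] using this
  have hsp : ⊤ ≤ Submodule.span ℝ (Set.range w) := by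
    intro X _
    -- Subtracting the expansion predicted by duality leaves a Killing field on which every
    -- functional vanishes.
    have hX : X - ∑ j, ψ j X • w j = 0 := by
      apply Subtype.ext
      apply h0 _ (X - ∑ j, ψ j X • w j).2
      intro i
      change ψ i (X - ∑ j, ψ j X • w j) = 0
      simp [map_sum, hψ]
    rw [sub_eq_zero.1 hX]
    exact Submodule.sum_mem _ fun j _ =>
      Submodule.smul_mem _ _ (Submodule.subset_span ⟨j, rfl⟩)
  let b := Module.Basis.mk hli hsp
  refine ⟨?_, b, fun i => ?_⟩
  · rw [Module.finrank_eq_card_basis b, Fintype.card_fin]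
  · simp [b, Module.Basis.mk_apply, w]

end PseudoRiemannianMetric

/-! ### Smoothness and derivatives of the explicit fields -/

namespace PlaneWaveKilling

/-- A derivative of a map into `ℝ⁴` computed componentwise along lines. -/
theorem fderiv_eq_of_line {X : R4 → R4} (hX : ContDiff ℝ ∞ X) {p u L : R4}
    (h : ∀ i, HasDerivAt (fun t : ℝ => X (p + t • u) i) (L i) 0) : fderiv ℝ X p u = L := by
  have h1 : HasLineDerivAt ℝ X (fderiv ℝ X p u) p u :=
    ((hX.differentiable (by simp)) p).hasFDerivAt.hasLineDerivAt u
  ext i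
  exact ((hasDerivAt_pi.1 h1) i).unique (h i)

theorem hasDerivAt_line (p u : R4) (i : Fin 4) :
    HasDerivAt (fun t : ℝ => (p + t • u) i) (u i) 0 := by
  simpa using ((hasDerivAt_id (0 : ℝ)).mul_const (u i)).const_add (p i)

theorem hasDerivAt_comp_line {h : ℝ → ℝ} (hh : ContDiff ℝ ∞ h) (p u : R4) (i : Fin 4) :
    HasDerivAt (fun t : ℝ => h ((p + t • u) i)) (deriv h (p i) * u i) 0 := by
  have h1 : HasDerivAt h (deriv h (p i)) ((p + (0 : ℝ) • u) i) := by
    simpa using (hh.differentiable (by simp) (p i)).hasDerivAt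
  exact h1.comp 0 (hasDerivAt_line p u i)

section Fields

variable {f : ℝ → ℝ}

theorem contDiff_deriv (hf : ContDiff ℝ ∞ f) : ContDiff ℝ ∞ (deriv f) :=
  (contDiff_infty_iff_deriv.1 hf).2

theorem deriv_primitive (hf : ContDiff ℝ ∞ f) : deriv (fun y => ∫ t in (0 : ℝ)..y, f t) = f :=
  funext fun y => hf.continuous.deriv_integral f 0 y

theorem contDiff_primitive (hf : ContDiff ℝ ∞ f) :
    ContDiff ℝ ∞ (fun y => ∫ t in (0 : ℝ)..y, f t) := by
  refine contDiff_infty_iff_deriv.2 ⟨fun y => ?_, by rwa [deriv_primitive hf]⟩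
  exact (hf.continuous.integral_hasStrictDerivAt 0 y).hasDerivAt.differentiableAt

theorem contDiff_X1 : ContDiff ℝ ∞ X1 := contDiff_const

theorem contDiff_X2 : ContDiff ℝ ∞ X2 := contDiff_const

theorem contDiff_X3 : ContDiff ℝ ∞ X3 := contDiff_const

theorem contDiff_X4 : ContDiff ℝ ∞ X4 := by
  refine contDiff_pi.2 fun i => ?_
  fin_cases i <;> simp [X4] <;> fun_prop

theorem contDiff_X5 (hf : ContDiff ℝ ∞ f) : ContDiff ℝ ∞ (X5 f) := by
  have := (contDiff_primitive hf).comp (contDiff_apply ℝ ℝ (1 : Fin 4))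
  refine contDiff_pi.2 fun i => ?_
  fin_cases i
  · simp [X5]; fun_prop
  · simp [X5]; fun_prop
  · exact contDiff_const.mul this
  · simp [X5]; fun_prop

theorem contDiff_X6const (hf : ContDiff ℝ ∞ f) (c : ℝ) : ContDiff ℝ ∞ (X6const f c) := by
  have hf1 := contDiff_deriv hf
  refine contDiff_pi.2 fun i => ?_
  fin_cases i <;> simp [X6const] <;> fun_prop

theorem contDiff_X7const (hf : ContDiff ℝ ∞ f) (c : ℝ) : ContDiff ℝ ∞ (X7const f c) := by
  have hf1 := contDiff_deriv hf
  refine contDiff_pi.2 fun i => ?_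
  fin_cases i <;> simp [X7const] <;> fun_prop

theorem contDiff_X8const (hf : ContDiff ℝ ∞ f) : ContDiff ℝ ∞ (X8const f) := by
  have hf1 := contDiff_deriv hf
  refine contDiff_pi.2 fun i => ?_
  fin_cases i <;> simp [X8const] <;> fun_prop

theorem contDiff_X9flat : ContDiff ℝ ∞ (X9flat f) := by
  refine contDiff_pi.2 fun i => ?_
  fin_cases i <;> simp [X9flat] <;> fun_prop

theorem contDiff_X10flat (hf : ContDiff ℝ ∞ f) : ContDiff ℝ ∞ (X10flat f) := by
  refine contDiff_pi.2 fun i => ?_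
  fin_cases i <;> simp [X10flat] <;> fun_prop

theorem contDiff_X6exp (hf : ContDiff ℝ ∞ f) (a l : ℝ) : ContDiff ℝ ∞ (X6exp f a l) := by
  have hf1 := contDiff_deriv hf
  refine contDiff_pi.2 fun i => ?_
  fin_cases i <;> simp [X6exp] <;> fun_prop

theorem contDiff_X6pow (hf : ContDiff ℝ ∞ f) (b : ℝ) (n : ℕ) : ContDiff ℝ ∞ (X6pow f b n) := by
  have hf1 := contDiff_deriv hf
  refine contDiff_pi.2 fun i => ?_
  fin_cases i <;> simp [X6pow] <;> fun_prop

theorem fderiv_X1 (p u : R4) : fderiv ℝ X1 p u = 0 := by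
  change fderiv ℝ (fun _ => ![1, 0, 0, 0]) p u = 0
  simp

theorem fderiv_X2 (p u : R4) : fderiv ℝ X2 p u = 0 := by
  change fderiv ℝ (fun _ => ![0, 0, 1, 0]) p u = 0
  simp

theorem fderiv_X3 (p u : R4) : fderiv ℝ X3 p u = 0 := by
  change fderiv ℝ (fun _ => ![0, 0, 0, 1]) p u = 0
  simp

theorem fderiv_X4 (p u : R4) : fderiv ℝ X4 p u = ![0, 0, -u 1, u 0] := by
  have x := hasDerivAt_line p u
  refine fderiv_eq_of_line contDiff_X4 fun i => ?_
  fin_cases i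
  · exact hasDerivAt_const _ _
  · exact hasDerivAt_const _ _
  · exact (x 1).neg
  · exact x 0

theorem fderiv_X5 (hf : ContDiff ℝ ∞ f) (p u : R4) :
    fderiv ℝ (X5 f) p u = ![u 1, 0, 2 * (f (p 1) * u 1), -u 2] := by
  have x := hasDerivAt_line p u
  have hF := hasDerivAt_comp_line (contDiff_primitive hf) p u 1
  rw [deriv_primitive hf] at hF
  refine fderiv_eq_of_line (contDiff_X5 hf) fun i => ?_
  fin_cases i
  · exact x 1
  · exact hasDerivAt_const _ _
  · exact hF.const_mul 2
  · exact (x 2).neg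

theorem fderiv_X6const (hf : ContDiff ℝ ∞ f) (c : ℝ) (p u : R4) :
    fderiv ℝ (X6const f c) p u = ![0, 0,
      u 0 * deriv f (p 1) + p 0 * (deriv (deriv f) (p 1) * u 1), -c * p 0 * u 0] := by
  have x := hasDerivAt_line p u
  have f1 := hasDerivAt_comp_line (contDiff_deriv hf) p u 1
  refine fderiv_eq_of_line (contDiff_X6const hf c) fun i => ?_
  fin_cases i
  · exact hasDerivAt_const _ _
  · exact hasDerivAt_const _ _
  · exact HasDerivAt.congr_deriv ((x 0).mul f1) (by simp)
  · exact HasDerivAt.congr_deriv (((x 0).pow 2).const_mul (-(c / 2))) (by simp; ring)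

theorem fderiv_X7const (hf : ContDiff ℝ ∞ f) (c : ℝ) (p u : R4) :
    fderiv ℝ (X7const f c) p u = ![0, u 0,
      p 0 * u 0 * deriv f (p 1) + p 0 ^ 2 * (deriv (deriv f) (p 1) * u 1) / 2 - u 3,
      -(c / 2) * p 0 ^ 2 * u 0] := by
  have x := hasDerivAt_line p u
  have f1 := hasDerivAt_comp_line (contDiff_deriv hf) p u 1
  refine fderiv_eq_of_line (contDiff_X7const hf c) fun i => ?_
  fin_cases i
  · exact hasDerivAt_const _ _
  · exact x 0
  · exact HasDerivAt.congr_deriv (((((x 0).pow 2).mul f1).div_const 2).sub (x 3)) (by simp; ring)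
  · exact HasDerivAt.congr_deriv (((x 0).pow 3).const_mul (-(c / 6))) (by simp; ring)

theorem fderiv_X8const (hf : ContDiff ℝ ∞ f) (p u : R4) :
    fderiv ℝ (X8const f) p u = ![u 0, -u 1,
      u 0 * (2 * f (p 1) - p 1 * deriv f (p 1)) +
        p 0 * (deriv f (p 1) * u 1 - p 1 * (deriv (deriv f) (p 1) * u 1)) - u 2,
      u 3 - deriv f 0 * p 0 * u 0] := by
  have x := hasDerivAt_line p u
  have f0 := hasDerivAt_comp_line hf p u 1
  have f1 := hasDerivAt_comp_line (contDiff_deriv hf) p u 1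
  refine fderiv_eq_of_line (contDiff_X8const hf) fun i => ?_
  fin_cases i
  · exact x 0
  · exact (x 1).neg
  · exact HasDerivAt.congr_deriv (((x 0).mul ((f0.const_mul 2).sub ((x 1).mul f1))).sub (x 2)) (by simp [-mul_eq_mul_left_iff]; ring)
  · exact HasDerivAt.congr_deriv ((x 3).sub ((((x 0).pow 2).const_mul (deriv f 0)).div_const 2)) (by simp; ring)

theorem fderiv_X9flat (p u : R4) :
    fderiv ℝ (X9flat f) p u = ![0, u 1, (u 0 * p 1 + p 0 * u 1) * deriv f 0,
      -(u 3 + deriv f 0 * p 0 * u 0)] := by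
  have x := hasDerivAt_line p u
  refine fderiv_eq_of_line contDiff_X9flat fun i => ?_
  fin_cases i
  · exact hasDerivAt_const _ _
  · exact x 1
  · exact HasDerivAt.congr_deriv (((x 0).mul (x 1)).mul_const (deriv f 0)) (by simp)
  · exact HasDerivAt.congr_deriv (((x 3).add ((((x 0).pow 2).const_mul (deriv f 0)).div_const 2)).neg) (by simp; ring)

theorem fderiv_X10flat (hf : ContDiff ℝ ∞ f) (p u : R4) :
    fderiv ℝ (X10flat f) p u =
      ![-(u 3 + deriv f 0 * p 0 * u 0), u 2 - (u 0 * f (p 1) + p 0 * (deriv f (p 1) * u 1)),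
        deriv f 0 * u 0 * (p 2 - p 0 * f (p 1)) +
          deriv f 0 * p 0 * (u 2 - (u 0 * f (p 1) + p 0 * (deriv f (p 1) * u 1))) -
          (deriv f (p 1) * u 1 * (p 3 + deriv f 0 * p 0 ^ 2 / 2) +
            f (p 1) * (u 3 + deriv f 0 * p 0 * u 0)),
        deriv f 0 * u 0 * (p 3 + deriv f 0 * p 0 ^ 2 / 2) +
          deriv f 0 * p 0 * (u 3 + deriv f 0 * p 0 * u 0)] := by
  have x := hasDerivAt_line p u
  have f0 := hasDerivAt_comp_line hf p u 1
  have hu := (x 2).sub ((x 0).mul f0)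
  have hv := (x 3).add ((((x 0).pow 2).const_mul (deriv f 0)).div_const 2)
  have hd := (x 0).const_mul (deriv f 0)
  refine fderiv_eq_of_line (contDiff_X10flat hf) fun i => ?_
  fin_cases i
  · exact HasDerivAt.congr_deriv (hv.neg) (by simp; ring)
  · exact HasDerivAt.congr_deriv (hu) (by simp)
  · exact HasDerivAt.congr_deriv ((hd.mul hu).sub (f0.mul hv)) (by simp [-mul_eq_mul_left_iff]; ring)
  · exact HasDerivAt.congr_deriv (hd.mul hv) (by simp [-mul_eq_mul_left_iff]; ring)

theorem fderiv_X6exp (hf : ContDiff ℝ ∞ f) (a l : ℝ) (p u : R4) :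
    fderiv ℝ (X6exp f a l) p u = ![-(l / 2) * u 0, 0,
      u 0 * (deriv f (p 1) - l * f (p 1)) +
        p 0 * (deriv (deriv f) (p 1) * u 1 - l * (deriv f (p 1) * u 1)) + l / 2 * u 2,
      -(a - l * deriv f 0) * p 0 * u 0] := by
  have x := hasDerivAt_line p u
  have f0 := hasDerivAt_comp_line hf p u 1
  have f1 := hasDerivAt_comp_line (contDiff_deriv hf) p u 1
  refine fderiv_eq_of_line (contDiff_X6exp hf a l) fun i => ?_
  fin_cases i
  · exact (x 0).const_mul _
  · exact hasDerivAt_const _ _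
  · exact HasDerivAt.congr_deriv (((x 0).mul (f1.sub (f0.const_mul l))).add ((x 2).const_mul (l / 2))) (by simp)
  · exact HasDerivAt.congr_deriv (((x 0).pow 2).const_mul (-((a - l * deriv f 0) / 2))) (by simp; ring)

theorem fderiv_X6pow (hf : ContDiff ℝ ∞ f) (b : ℝ) (n : ℕ) (p u : R4) :
    fderiv ℝ (X6pow f b n) p u = ![u 0, -(2 / (n + 2)) * u 1,
      u 0 * (2 * f (p 1) - 2 / (n + 2) * (p 1 + b) * deriv f (p 1)) +
        p 0 * (2 * (deriv f (p 1) * u 1) - (2 / (n + 2) * u 1 * deriv f (p 1) +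
          2 / (n + 2) * (p 1 + b) * (deriv (deriv f) (p 1) * u 1))) - u 2,
      2 / (n + 2) * u 3 - (n + 1) / (n + 2) * deriv f (-b) * (2 * p 0 * u 0)] := by
  have x := hasDerivAt_line p u
  have f0 := hasDerivAt_comp_line hf p u 1
  have f1 := hasDerivAt_comp_line (contDiff_deriv hf) p u 1
  have hb := (x 1).add_const b
  refine fderiv_eq_of_line (contDiff_X6pow hf b n) fun i => ?_
  fin_cases i
  · exact x 0
  · exact hb.const_mul _
  · exact HasDerivAt.congr_deriv (((x 0).mul ((f0.const_mul 2).sub ((hb.const_mul (2 / (n + 2 : ℝ))).mul f1))).sub (x 2)) (by simp)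
  · exact HasDerivAt.congr_deriv (((x 3).const_mul (2 / (n + 2 : ℝ))).sub
      (((x 0).pow 2).const_mul ((n + 1) / (n + 2 : ℝ) * deriv f (-b)))) (by simp)

end Fields

end PlaneWaveKilling

/-! ### Calculus of partial derivatives on ℝ⁴ -/

namespace PlaneWaveKilling

/-- The partial derivative of a function on `ℝ⁴` in the `i`-th coordinate. -/
noncomputable def pd (i : Fin 4) (φ : R4 → ℝ) (p : R4) : ℝ := fderiv ℝ φ p (Pi.single i 1)

theorem contDiff_pd {φ : R4 → ℝ} (hφ : ContDiff ℝ ∞ φ) (i : Fin 4) : ContDiff ℝ ∞ (pd i φ) :=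
  (ContDiff.fderiv_right (m := ∞) hφ le_rfl).clm_apply contDiff_const

theorem pd_comm {φ : R4 → ℝ} (hφ : ContDiff ℝ ∞ φ) (i j : Fin 4) :
    pd i (pd j φ) = pd j (pd i φ) := by
  funext p
  have h1 : DifferentiableAt ℝ (fderiv ℝ φ) p :=
    (ContDiff.fderiv_right (m := ∞) hφ le_rfl).differentiable (by simp) p
  have h (i j : Fin 4) : pd i (pd j φ) p =
      fderiv ℝ (fderiv ℝ φ) p (Pi.single i 1) (Pi.single j 1) := by
    change fderiv ℝ (fun q => fderiv ℝ φ q (Pi.single j 1)) p (Pi.single i 1) = _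
    rw [fderiv_clm_apply h1 (differentiableAt_const _)]
    simp
  rw [h, h]
  exact (hφ.contDiffAt.isSymmSndFDerivAt
    (by rw [minSmoothness_of_isRCLikeNormedField]; exact WithTop.coe_le_coe.2 le_top)) _ _

theorem pd_zero (i : Fin 4) : pd i (fun _ => 0) = fun _ => 0 := by
  funext p; simp [pd]

theorem pd_add {φ ψ : R4 → ℝ} (hφ : ContDiff ℝ ∞ φ) (hψ : ContDiff ℝ ∞ ψ) (i : Fin 4) :
    pd i (fun p => φ p + ψ p) = fun p => pd i φ p + pd i ψ p := by
  funext p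
  simp [pd, fderiv_fun_add (hφ.differentiable (by simp) p) (hψ.differentiable (by simp) p)]

theorem pd_neg (φ : R4 → ℝ) (i : Fin 4) : pd i (fun p => -φ p) = fun p => -pd i φ p := by
  funext p
  simp [pd, fderiv_fun_neg]

theorem pd_sub {φ ψ : R4 → ℝ} (hφ : ContDiff ℝ ∞ φ) (hψ : ContDiff ℝ ∞ ψ) (i : Fin 4) :
    pd i (fun p => φ p - ψ p) = fun p => pd i φ p - pd i ψ p := by
  funext p
  simp [pd, fderiv_fun_sub (hφ.differentiable (by simp) p) (hψ.differentiable (by simp) p)]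

theorem pd_const_mul {φ : R4 → ℝ} (hφ : ContDiff ℝ ∞ φ) (c : ℝ) (i : Fin 4) :
    pd i (fun p => c * φ p) = fun p => c * pd i φ p := by
  funext p
  simp [pd, fderiv_const_mul (hφ.differentiable (by simp) p)]

/-- The coefficients of the Killing equations depend on y alone, so only ∂_y produces an extra term.
-/
theorem pd_mul {φ : R4 → ℝ} (hφ : ContDiff ℝ ∞ φ) {h : ℝ → ℝ} (hh : ContDiff ℝ ∞ h)
    (i : Fin 4) :
    pd i (fun p => h (p 1) * φ p) =
      fun p => h (p 1) * pd i φ p + (if i = 1 then 1 else 0) * (deriv h (p 1) * φ p) := by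
  funext p
  have h1 : HasFDerivAt (fun p : R4 => h (p 1)) _ p :=
    ((hh.differentiable (by simp) (p 1)).hasDerivAt).comp_hasFDerivAt p
      (ContinuousLinearMap.proj (R := ℝ) (φ := fun _ : Fin 4 => ℝ) 1).hasFDerivAt
  have h2 := h1.mul ((hφ.differentiable (by simp) p).hasFDerivAt)
  simp only [pd]
  rw [show (fun p : R4 => h (p 1) * φ p) = (fun p : R4 => h (p 1)) * φ from rfl, h2.fderiv]
  by_cases hi : i = 1
  · subst hi; simp; ring
  · simp [hi, Ne.symm hi]

theorem fderiv_eq_zero_of_pd {φ : R4 → ℝ} {p : R4} (h : ∀ i, pd i φ p = 0) :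
    fderiv ℝ φ p = 0 := by
  ext u
  have hu : u = ∑ i, u i • (Pi.single i 1 : R4) := by
    ext j; simp [Finset.sum_apply, Pi.single_apply]
  rw [hu, map_sum]
  simp only [pd] at h
  simp [h]

theorem eq_zero_of_pd {φ : R4 → ℝ} (hφ : ContDiff ℝ ∞ φ) (h : ∀ i, pd i φ = fun _ => 0)
    (h0 : φ 0 = 0) : φ = fun _ => 0 := by
  funext p
  rw [← h0]
  exact is_const_of_fderiv_eq_zero (hφ.differentiable (by simp))
    (fun q => fderiv_eq_zero_of_pd fun i => congrFun (h i) q) p 0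

theorem pd_coord {X : R4 → R4} (hX : ContDiff ℝ ∞ X) (i k : Fin 4) (p : R4) :
    pd i (fun q => X q k) p = fderiv ℝ X p (Pi.single i 1) k := by
  rw [pd, fderiv_apply (hX.differentiable (by simp) p)]
  rfl

/-- Restriction of a function on `ℝ⁴` to the `y`-axis. -/
theorem hasDerivAt_axis {φ : R4 → ℝ} (hφ : ContDiff ℝ ∞ φ) (y : ℝ) :
    HasDerivAt (fun t : ℝ => φ (Pi.single 1 t)) (pd 1 φ (Pi.single 1 y)) y := by
  have h1 : HasDerivAt (fun t : ℝ => (Pi.single 1 t : R4)) (Pi.single 1 1) y := by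
    refine hasDerivAt_pi.2 fun i => ?_
    by_cases hi : i = 1
    · subst hi; simpa using hasDerivAt_id' y
    · simpa [hi] using hasDerivAt_const y (0 : ℝ)
  exact ((hφ.differentiable (by simp) _).hasFDerivAt).comp_hasDerivAt y h1

theorem axis_eq_const {φ : R4 → ℝ} (hφ : ContDiff ℝ ∞ φ) (h : pd 1 φ = fun _ => 0) (y : ℝ) :
    φ (Pi.single 1 y) = φ 0 := by
  have := is_const_of_deriv_eq_zero (f := fun t : ℝ => φ (Pi.single 1 t))
    (fun t => (hasDerivAt_axis hφ t).differentiableAt)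
    (fun t => by rw [(hasDerivAt_axis hφ t).deriv, h]) y 0
  simpa using this

theorem axis_eq_affine {φ : R4 → ℝ} (hφ : ContDiff ℝ ∞ φ) (h : pd 1 (pd 1 φ) = fun _ => 0)
    (y : ℝ) : φ (Pi.single 1 y) = φ 0 + pd 1 φ 0 * y := by
  have h1 (t : ℝ) : HasDerivAt (fun t : ℝ => φ (Pi.single 1 t) - pd 1 φ 0 * t) 0 t := by
    have := (hasDerivAt_axis hφ t).sub ((hasDerivAt_id t).const_mul (pd 1 φ 0))
    rw [axis_eq_const (contDiff_pd hφ 1) h] at this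
    exact this.congr_deriv (by simp)
  have := is_const_of_deriv_eq_zero (fun t => (h1 t).differentiableAt)
    (fun t => (h1 t).deriv) y 0
  simp at this
  linarith

/-! ### The Killing equations in coordinates -/

section

variable {f : ℝ → ℝ} {hf : AnalyticOnNhd ℝ f Set.univ}

theorem contDiff_of_analytic (hf : AnalyticOnNhd ℝ f Set.univ) : ContDiff ℝ ∞ f :=
  contDiff_iff_contDiffAt.2 fun y => (hf y (Set.mem_univ y)).contDiffAt

theorem planeWave_val (p u v : R4) : (planeWave f hf).val p u v =
    -2 * f (p 1) * (u 0 * v 0) + (u 0 * v 2 + u 2 * v 0) + (u 1 * v 3 + u 3 * v 1) := by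
  simp [planeWave]

theorem fderiv_planeWave_val (p w u v : R4) : fderiv ℝ (planeWave f hf).val p w u v =
    -2 * (deriv f (p 1) * w 1) * (u 0 * v 0) := by
  have h1 : HasFDerivAt (fun p : R4 => f (p 1)) _ p :=
    (((contDiff_of_analytic hf).differentiable (by simp) (p 1)).hasDerivAt).comp_hasFDerivAt p
      (ContinuousLinearMap.proj (R := ℝ) (φ := fun _ : Fin 4 => ℝ) 1).hasFDerivAt
  have h2 := ((((h1.const_mul (-2)).smul_const (dxTensor 0 0)).add_const
    (dxTensor 0 2 + dxTensor 2 0)).add_const (dxTensor 1 3 + dxTensor 3 1))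
  have h3 : HasFDerivAt (planeWave f hf).val _ p := h2
  rw [h3.fderiv]
  simp

theorem lieDeriv_planeWave (X : R4 → R4) (p u v : R4) :
    (planeWave f hf).lieDeriv X p u v =
      -2 * (deriv f (p 1) * X p 1) * (u 0 * v 0)
      + (-2 * f (p 1) * (fderiv ℝ X p u 0 * v 0) + (fderiv ℝ X p u 0 * v 2 + fderiv ℝ X p u 2 * v 0)
        + (fderiv ℝ X p u 1 * v 3 + fderiv ℝ X p u 3 * v 1))
      + (-2 * f (p 1) * (u 0 * fderiv ℝ X p v 0) + (u 0 * fderiv ℝ X p v 2 + u 2 * fderiv ℝ X p v 0)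
        + (u 1 * fderiv ℝ X p v 3 + u 3 * fderiv ℝ X p v 1)) := by
  rw [PseudoRiemannianMetric.lieDeriv, fderiv_planeWave_val, planeWave_val, planeWave_val]

/-- The Killing equations of a plane wave for a field with components `A, B, C, D`. -/
structure KillingSystem (f : ℝ → ℝ) (A B C D : R4 → ℝ) : Prop where
  smoothA : ContDiff ℝ ∞ A
  smoothB : ContDiff ℝ ∞ B
  smoothC : ContDiff ℝ ∞ C
  smoothD : ContDiff ℝ ∞ D
  xx : pd 0 C = fun p => deriv f (p 1) * B p + 2 * (f (p 1) * pd 0 A p)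
  xy : pd 1 C = fun p => 2 * (f (p 1) * pd 1 A p) - pd 0 D p
  xp : pd 2 C = fun p => -pd 0 A p
  xq : pd 3 C = fun p => 2 * (f (p 1) * pd 3 A p) - pd 0 B p
  yy : pd 1 D = fun _ => 0
  yp : pd 2 D = fun p => -pd 1 A p
  yq : pd 3 D = fun p => -pd 1 B p
  pp : pd 2 A = fun _ => 0
  pq : pd 3 A = fun p => -pd 2 B p
  qq : pd 3 B = fun _ => 0

theorem killingSystem_of_isKilling {X : R4 → R4} (hX : ContDiff ℝ ∞ X)
    (hK : (planeWave f hf).IsKilling X) :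
    KillingSystem f (fun p => X p 0) (fun p => X p 1) (fun p => X p 2) (fun p => X p 3) := by
  have hs (k : Fin 4) : ContDiff ℝ ∞ (fun p => X p k) := contDiff_pi.1 hX k
  have e (i j : Fin 4) (p : R4) := hK p (Pi.single i 1) (Pi.single j 1)
  simp only [lieDeriv_planeWave, ← pd_coord hX] at e
  -- Proved ahead of the other components because the (x, x̃) equation contains the term -2 f A_p,
  -- which this removes.
  have e22 (p : R4) : pd 2 (fun q => X q 0) p = 0 := by
    have := e 2 2 p; simp at this; linarith
  constructor
  · exact hs 0
  · exact hs 1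
  · exact hs 2
  · exact hs 3
  · funext p; have := e 0 0 p; simp at this; linarith
  · funext p; have := e 0 1 p; simp at this; linarith
  · funext p; have := e 0 2 p; have := e22 p; simp [e22] at *; linarith
  · funext p; have := e 0 3 p; simp at this; linarith
  · funext p; have := e 1 1 p; simp at this; linarith
  · funext p; have := e 1 2 p; simp at this; linarith
  · funext p; have := e 1 3 p; simp at this; linarith
  · funext p; exact e22 p
  · funext p; have := e 2 3 p; simp at this; linarith
  · funext p; have := e 3 3 p; simp at this; linarith

end

/-! ### Prolongation: second derivatives and compatibility conditions -/

namespace KillingSystem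

variable {f : ℝ → ℝ} {A B C D : R4 → ℝ}

/-- A_yy comes from D_yp with D_y = 0. For A_yq, the two expressions for D_pq give A_yq = B_yp,
while A_q = -B_p gives the opposite sign. -/
theorem pd_A_mixed (h : KillingSystem f A B C D) :
    pd 1 (pd 1 A) = (fun _ => 0) ∧ pd 1 (pd 3 A) = (fun _ => 0) ∧
    (∀ i, pd i (pd 2 A) = fun _ => 0) := by
  have h2 : ∀ i, pd i (pd 2 A) = fun _ => 0 := fun i => by rw [h.pp, pd_zero]
  refine ⟨?_, ?_, h2⟩
  · have e1 := congrArg (pd 1) h.yp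
    rw [pd_neg, pd_comm h.smoothD, h.yy, pd_zero] at e1
    funext p; have := congrFun e1 p; simp at this; exact this
  · have e1 := congrArg (pd 1) h.pq
    have e2 := congrArg (pd 3) h.yp
    have e3 := congrArg (pd 2) h.yq
    rw [pd_neg] at e1 e2 e3
    rw [pd_comm h.smoothD 3 2, e3, pd_comm h.smoothA 3 1, pd_comm h.smoothB 2 1] at e2
    funext p
    have := congrFun e1 p
    have := congrFun e2 p
    simp at *; linarith

theorem pd_B_mixed (h : KillingSystem f A B C D) :
    pd 1 (pd 1 B) = (fun _ => 0) ∧ pd 1 (pd 2 B) = (fun _ => 0) ∧ pd 2 (pd 2 B) = (fun _ => 0) ∧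
    (∀ i, pd i (pd 3 B) = fun _ => 0) := by
  have h2 : ∀ i, pd i (pd 3 B) = fun _ => 0 := fun i => by rw [h.qq, pd_zero]
  have hB : pd 2 B = fun p => -pd 3 A p := by rw [h.pq]; simp
  obtain ⟨-, h13, hA2⟩ := h.pd_A_mixed
  refine ⟨?_, ?_, ?_, h2⟩
  · have e1 := congrArg (pd 1) h.yq
    rw [pd_neg, pd_comm h.smoothD, h.yy, pd_zero] at e1
    funext p; have := congrFun e1 p; simp at this; exact this
  · rw [hB, pd_neg, h13]; simp
  · rw [hB, pd_neg, pd_comm h.smoothA, hA2]; simp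

/-- The two expressions for C_pq give A_xq = B_xp, and A_q = -B_p gives A_xq = -B_xp. -/
theorem pd_xA_xB (h : KillingSystem f A B C D) (hf : ContDiff ℝ ∞ f) :
    pd 0 (pd 3 A) = (fun _ => 0) ∧ pd 0 (pd 2 B) = (fun _ => 0) := by
  have e1 := congrArg (pd 3) h.xp
  have e2 := congrArg (pd 2) h.xq
  have e3 := congrArg (pd 0) h.pq
  obtain ⟨-, -, hA2⟩ := h.pd_A_mixed
  have s3 := contDiff_pd h.smoothA 3
  have s0 := contDiff_pd h.smoothB 0
  have sf : ContDiff ℝ ∞ (fun p : R4 => f (p 1)) := hf.comp (contDiff_apply ℝ ℝ 1)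
  rw [pd_neg] at e1 e3
  rw [pd_sub (contDiff_const.mul (sf.mul s3)) s0, pd_const_mul (sf.mul s3), pd_mul s3 hf,
    pd_comm h.smoothA 2 3, hA2, pd_comm h.smoothB 2 0, pd_comm h.smoothC, e1,
    pd_comm h.smoothA 3 0] at e2
  constructor <;> funext p <;> have := congrFun e2 p <;> have := congrFun e3 p <;> simp at * <;>
    linarith

/-- `∂_x̃` of the `∂_y`-component of a Killing field is constant. -/
theorem pd_pB (h : KillingSystem f A B C D) (hf : ContDiff ℝ ∞ f) (i : Fin 4) :
    pd i (pd 2 B) = fun _ => 0 := by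
  obtain ⟨-, h12, h22, hB⟩ := h.pd_B_mixed
  fin_cases i
  · exact (h.pd_xA_xB hf).2
  · exact h12
  · exact h22
  · exact (pd_comm h.smoothB 3 2).trans (hB 2)

/-- One expression for C_yp is -A_xy; the other is -D_xp = A_xy. -/
theorem pd_xyA (h : KillingSystem f A B C D) (hf : ContDiff ℝ ∞ f) :
    pd 0 (pd 1 A) = fun _ => 0 := by
  have e1 := congrArg (pd 1) h.xp
  have e2 := congrArg (pd 2) h.xy
  have e3 := congrArg (pd 0) h.yp
  obtain ⟨-, -, hA2⟩ := h.pd_A_mixed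
  have s1 := contDiff_pd h.smoothA 1
  have s0 := contDiff_pd h.smoothD 0
  have sf : ContDiff ℝ ∞ (fun p : R4 => f (p 1)) := hf.comp (contDiff_apply ℝ ℝ 1)
  rw [pd_neg] at e1 e3
  rw [pd_sub (contDiff_const.mul (sf.mul s1)) s0, pd_const_mul (sf.mul s1), pd_mul s1 hf,
    pd_comm h.smoothA 2 1, hA2, pd_comm h.smoothD 2 0, pd_comm h.smoothC, e1, e3,
    pd_comm h.smoothA 1 0] at e2
  funext p; have := congrFun e2 p; simp at *; linarith

/-- Compare the two expressions for C_yq: 2 f' A_q - B_xy and -D_xq = B_xy, then use A_q = -B_p. -/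
theorem pd_xyB (h : KillingSystem f A B C D) (hf : ContDiff ℝ ∞ f) :
    pd 1 (pd 0 B) = fun p => -(deriv f (p 1) * pd 2 B p) := by
  have e1 := congrArg (pd 1) h.xq
  have e2 := congrArg (pd 3) h.xy
  have e3 := congrArg (pd 0) h.yq
  obtain ⟨-, hA13, -⟩ := h.pd_A_mixed
  have s1 := contDiff_pd h.smoothA 1
  have s3 := contDiff_pd h.smoothA 3
  have t0 := contDiff_pd h.smoothB 0
  have s0 := contDiff_pd h.smoothD 0
  have sf : ContDiff ℝ ∞ (fun p : R4 => f (p 1)) := hf.comp (contDiff_apply ℝ ℝ 1)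
  rw [pd_neg, pd_comm h.smoothB 0 1] at e3
  rw [pd_sub (contDiff_const.mul (sf.mul s1)) s0, pd_const_mul (sf.mul s1), pd_mul s1 hf,
    pd_comm h.smoothA 3 1, hA13, pd_comm h.smoothD 3 0, e3, pd_comm h.smoothC] at e2
  rw [pd_sub (contDiff_const.mul (sf.mul s3)) t0, pd_const_mul (sf.mul s3), pd_mul s3 hf,
    hA13, e2, h.pq] at e1
  funext p; have := congrFun e1 p; simp at *; linarith

/-- Compare the two expressions for C_xp. -/
theorem pd_xxA (h : KillingSystem f A B C D) (hf : ContDiff ℝ ∞ f) :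
    pd 0 (pd 0 A) = fun p => -(deriv f (p 1) * pd 2 B p) := by
  have e1 := congrArg (pd 0) h.xp
  have e2 := congrArg (pd 2) h.xx
  obtain ⟨-, -, hA2⟩ := h.pd_A_mixed
  have s0 := contDiff_pd h.smoothA 0
  have sf : ContDiff ℝ ∞ (fun p : R4 => f (p 1)) := hf.comp (contDiff_apply ℝ ℝ 1)
  have sf' : ContDiff ℝ ∞ (fun p : R4 => deriv f (p 1)) :=
    (contDiff_deriv hf).comp (contDiff_apply ℝ ℝ 1)
  rw [pd_neg] at e1
  rw [pd_add (sf'.mul h.smoothB) (contDiff_const.mul (sf.mul s0)), pd_const_mul (sf.mul s0),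
    pd_mul s0 hf, pd_mul h.smoothB (contDiff_deriv hf), pd_comm h.smoothA 2 0, hA2,
    pd_comm h.smoothC 2 0, e1] at e2
  funext p; have := congrFun e2 p; simp at *; linarith

/-- Compare the two expressions for C_xq; the terms with A_xq are already known to vanish. -/
theorem pd_xxB (h : KillingSystem f A B C D) (hf : ContDiff ℝ ∞ f) :
    pd 0 (pd 0 B) = fun _ => 0 := by
  have e1 := congrArg (pd 0) h.xq
  have e2 := congrArg (pd 3) h.xx
  have hA03 := (h.pd_xA_xB hf).1
  have s0 := contDiff_pd h.smoothA 0
  have s3 := contDiff_pd h.smoothA 3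
  have t0 := contDiff_pd h.smoothB 0
  have sf : ContDiff ℝ ∞ (fun p : R4 => f (p 1)) := hf.comp (contDiff_apply ℝ ℝ 1)
  have sf' : ContDiff ℝ ∞ (fun p : R4 => deriv f (p 1)) :=
    (contDiff_deriv hf).comp (contDiff_apply ℝ ℝ 1)
  rw [pd_sub (contDiff_const.mul (sf.mul s3)) t0, pd_const_mul (sf.mul s3), pd_mul s3 hf,
    hA03] at e1
  rw [pd_add (sf'.mul h.smoothB) (contDiff_const.mul (sf.mul s0)), pd_const_mul (sf.mul s0),
    pd_mul s0 hf, pd_mul h.smoothB (contDiff_deriv hf), pd_comm h.smoothA 3 0, hA03, h.qq,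
    pd_comm h.smoothC 3 0, e1] at e2
  funext p; have := congrFun e2 p; simp at *; linarith

/-- Compare the two expressions for C_xy. This is where f'' first enters. -/
theorem pd_xxD (h : KillingSystem f A B C D) (hf : ContDiff ℝ ∞ f) :
    pd 0 (pd 0 D) = fun p => -(deriv (deriv f) (p 1) * B p
      + deriv f (p 1) * (pd 1 B p + 2 * pd 0 A p)) := by
  have e1 := congrArg (pd 0) h.xy
  have e2 := congrArg (pd 1) h.xx
  have hA01 := h.pd_xyA hf
  have s0 := contDiff_pd h.smoothA 0
  have s1 := contDiff_pd h.smoothA 1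
  have t0 := contDiff_pd h.smoothD 0
  have sf : ContDiff ℝ ∞ (fun p : R4 => f (p 1)) := hf.comp (contDiff_apply ℝ ℝ 1)
  have sf' : ContDiff ℝ ∞ (fun p : R4 => deriv f (p 1)) :=
    (contDiff_deriv hf).comp (contDiff_apply ℝ ℝ 1)
  rw [pd_sub (contDiff_const.mul (sf.mul s1)) t0, pd_const_mul (sf.mul s1), pd_mul s1 hf,
    hA01] at e1
  rw [pd_add (sf'.mul h.smoothB) (contDiff_const.mul (sf.mul s0)), pd_const_mul (sf.mul s0),
    pd_mul s0 hf, pd_mul h.smoothB (contDiff_deriv hf), pd_comm h.smoothA 1 0, hA01,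
    pd_comm h.smoothC 1 0, e1] at e2
  funext p; have := congrFun e2 p; simp at *; linarith

theorem pB_const (h : KillingSystem f A B C D) (hf : ContDiff ℝ ∞ f) (p : R4) :
    pd 2 B p = pd 2 B 0 :=
  is_const_of_fderiv_eq_zero ((contDiff_pd h.smoothB 2).differentiable (by simp))
    (fun q => fderiv_eq_zero_of_pd fun i => congrFun (h.pd_pB hf i) q) p 0

/-- Differentiate A_xx = -f' B_p in y: the left side dies because A_xy = 0, and B_p is constant. -/
theorem pB_mul_deriv2 (h : KillingSystem f A B C D) (hf : ContDiff ℝ ∞ f) (y : ℝ) :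
    deriv (deriv f) y * pd 2 B 0 = 0 := by
  have e := congrArg (pd 1) (h.pd_xxA hf)
  rw [pd_neg, pd_mul (contDiff_pd h.smoothB 2) (contDiff_deriv hf), h.pd_pB hf,
    pd_comm (contDiff_pd h.smoothA 0), pd_comm h.smoothA 1 0, h.pd_xyA hf, pd_zero] at e
  have := congrFun e (Pi.single 1 y)
  simp [h.pB_const hf] at this
  simpa using this

/-- Differentiate the formula for D_xx in y. The left side vanishes since D_y = 0, and B_yy = A_xy =
0 removes the term with f'. -/
theorem deriv3_identity (h : KillingSystem f A B C D) (hf : ContDiff ℝ ∞ f) (p : R4) :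
    deriv (deriv (deriv f)) (p 1) * B p
      + deriv (deriv f) (p 1) * (2 * pd 1 B p + 2 * pd 0 A p) = 0 := by
  have e := congrArg (pd 1) (h.pd_xxD hf)
  have sf1 := contDiff_deriv hf
  have sf2 := contDiff_deriv sf1
  have s0 := contDiff_pd h.smoothA 0
  have t1 := contDiff_pd h.smoothB 1
  have sf' : ContDiff ℝ ∞ (fun p : R4 => deriv f (p 1)) := sf1.comp (contDiff_apply ℝ ℝ 1)
  have sf'' : ContDiff ℝ ∞ (fun p : R4 => deriv (deriv f) (p 1)) :=
    sf2.comp (contDiff_apply ℝ ℝ 1)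
  have sm : ContDiff ℝ ∞ (fun p => pd 1 B p + 2 * pd 0 A p) := t1.add (contDiff_const.mul s0)
  rw [pd_neg, pd_add (sf''.mul h.smoothB) (sf'.mul sm), pd_mul h.smoothB sf2, pd_mul sm sf1,
    pd_add t1 (contDiff_const.mul s0), pd_const_mul s0, pd_comm h.smoothA 1 0, h.pd_xyA hf,
    h.pd_B_mixed.1, pd_comm (contDiff_pd h.smoothD 0), pd_comm h.smoothD 1 0, h.yy, pd_zero,
    pd_zero] at e
  have := congrFun e p
  simp at this
  linarith

/-- The affine constraint on the data at the origin. -/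
theorem deriv3_axis (h : KillingSystem f A B C D) (hf : ContDiff ℝ ∞ f) (y : ℝ) :
    deriv (deriv (deriv f)) y * (B 0 + pd 1 B 0 * y)
      + deriv (deriv f) y * (2 * pd 1 B 0 + 2 * pd 0 A 0) = 0 := by
  have e := h.deriv3_identity hf (Pi.single 1 y)
  rw [axis_eq_affine h.smoothB h.pd_B_mixed.1,
    axis_eq_const (contDiff_pd h.smoothB 1) h.pd_B_mixed.1,
    axis_eq_const (contDiff_pd h.smoothA 0)
      ((pd_comm h.smoothA 1 0).trans (h.pd_xyA hf))] at e
  simpa using e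

/-- Differentiate `deriv3_identity` in x. Once B_p = 0, both B_xy and A_xx vanish, so only f''' B_x
is left, with B_x constant along the y-axis. -/
theorem deriv3_mul_xB (h : KillingSystem f A B C D) (hf : ContDiff ℝ ∞ f) (h2 : pd 2 B 0 = 0)
    (y : ℝ) : deriv (deriv (deriv f)) y * pd 0 B 0 = 0 := by
  have hβ : pd 2 B = fun _ => 0 := funext fun p => by rw [h.pB_const hf, h2]
  have sf2 := contDiff_deriv (contDiff_deriv hf)
  have s0 := contDiff_pd h.smoothA 0
  have t1 := contDiff_pd h.smoothB 1
  have hB : pd 1 (pd 0 B) = fun _ => 0 := by rw [h.pd_xyB hf, hβ]; simp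
  have hA : pd 0 (pd 0 A) = fun _ => 0 := by rw [h.pd_xxA hf, hβ]; simp
  have sf'' : ContDiff ℝ ∞ (fun p : R4 => deriv (deriv f) (p 1)) :=
    sf2.comp (contDiff_apply ℝ ℝ 1)
  have sf''' : ContDiff ℝ ∞ (fun p : R4 => deriv (deriv (deriv f)) (p 1)) :=
    (contDiff_deriv sf2).comp (contDiff_apply ℝ ℝ 1)
  have sm : ContDiff ℝ ∞ (fun p => 2 * pd 1 B p + 2 * pd 0 A p) :=
    (contDiff_const.mul t1).add (contDiff_const.mul s0)
  have e := congrArg (pd 0) (funext (h.deriv3_identity hf))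
  rw [pd_add (sf'''.mul h.smoothB) (sf''.mul sm), pd_mul h.smoothB (contDiff_deriv sf2),
    pd_mul sm sf2, pd_add (contDiff_const.mul t1) (contDiff_const.mul s0), pd_const_mul t1,
    pd_const_mul s0, hA, pd_comm h.smoothB 0 1, hB, pd_zero] at e
  have := congrFun e (Pi.single 1 y)
  simp only [axis_eq_const (contDiff_pd h.smoothB 0) hB] at this
  simpa using this

/-- A Killing field is determined by ten numbers at the origin. -/
theorem eq_zero (h : KillingSystem f A B C D) (hf : ContDiff ℝ ∞ f)
    (a : A 0 = 0) (ax : pd 0 A 0 = 0) (ay : pd 1 A 0 = 0) (b : B 0 = 0) (bx : pd 0 B 0 = 0)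
    (b_y : pd 1 B 0 = 0) (bp : pd 2 B 0 = 0) (c : C 0 = 0) (d : D 0 = 0) (dx : pd 0 D 0 = 0) :
    A = (fun _ => 0) ∧ B = (fun _ => 0) ∧ C = (fun _ => 0) ∧ D = (fun _ => 0) := by
  obtain ⟨a11, a13, ai2⟩ := h.pd_A_mixed
  obtain ⟨b11, b12, b22, bi3⟩ := h.pd_B_mixed
  obtain ⟨a03, b02⟩ := h.pd_xA_xB hf
  have a01 := h.pd_xyA hf
  have hB2 : pd 2 B = fun _ => 0 := funext fun p => by rw [h.pB_const hf, bp]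
  have a00 : pd 0 (pd 0 A) = fun _ => 0 := by rw [h.pd_xxA hf, hB2]; simp
  have b10 : pd 1 (pd 0 B) = fun _ => 0 := by rw [h.pd_xyB hf, hB2]; simp
  have b00 := h.pd_xxB hf
  -- The pattern for what follows: a function with vanishing gradient and value zero at the origin
  -- is zero, applied to first derivatives before the components themselves.
  have hA0 : pd 0 A = fun _ => 0 := by
    refine eq_zero_of_pd (contDiff_pd h.smoothA 0) (fun i => ?_) ax
    rw [pd_comm h.smoothA]
    fin_cases i
    · exact a00
    · exact a01
    · exact ai2 0
    · exact a03
  have hA1 : pd 1 A = fun _ => 0 := by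
    refine eq_zero_of_pd (contDiff_pd h.smoothA 1) (fun i => ?_) ay
    rw [pd_comm h.smoothA]
    fin_cases i
    · exact (pd_comm h.smoothA _ _).trans a01
    · exact a11
    · exact ai2 1
    · exact a13
  have hA3 : pd 3 A = fun _ => 0 := by rw [h.pq, hB2]; simp
  have hA : A = fun _ => 0 := by
    refine eq_zero_of_pd h.smoothA (fun i => ?_) a
    fin_cases i
    · exact hA0
    · exact hA1
    · exact h.pp
    · exact hA3
  have hB0 : pd 0 B = fun _ => 0 := by
    refine eq_zero_of_pd (contDiff_pd h.smoothB 0) (fun i => ?_) bx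
    fin_cases i
    · exact b00
    · exact b10
    · exact (pd_comm h.smoothB _ _).trans b02
    · exact (pd_comm h.smoothB _ _).trans (bi3 0)
  have hB1 : pd 1 B = fun _ => 0 := by
    refine eq_zero_of_pd (contDiff_pd h.smoothB 1) (fun i => ?_) b_y
    fin_cases i
    · exact (pd_comm h.smoothB _ _).trans b10
    · exact b11
    · exact (pd_comm h.smoothB _ _).trans b12
    · exact (pd_comm h.smoothB _ _).trans (bi3 1)
  have hB : B = fun _ => 0 := by
    refine eq_zero_of_pd h.smoothB (fun i => ?_) b
    fin_cases i
    · exact hB0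
    · exact hB1
    · exact hB2
    · exact h.qq
  have hD2 : pd 2 D = fun _ => 0 := by rw [h.yp, hA1]; simp
  have hD3 : pd 3 D = fun _ => 0 := by rw [h.yq, hB1]; simp
  have hz (i : Fin 4) (hi : pd i D = fun _ => 0) : pd i (pd 0 D) = fun _ => 0 := by
    rw [pd_comm h.smoothD, hi, pd_zero]
  have hD0 : pd 0 D = fun _ => 0 := by
    refine eq_zero_of_pd (contDiff_pd h.smoothD 0) (fun i => ?_) dx
    fin_cases i
    -- D_xx is a combination of B, B_y and A_x, so it vanishes only now that A and B are settled.
    · refine (h.pd_xxD hf).trans ?_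
      rw [hB, hA0, pd_zero]; simp
    · exact hz 1 h.yy
    · exact hz 2 hD2
    · exact hz 3 hD3
  have hD : D = fun _ => 0 := by
    refine eq_zero_of_pd h.smoothD (fun i => ?_) d
    fin_cases i
    · exact hD0
    · exact h.yy
    · exact hD2
    · exact hD3
  refine ⟨hA, hB, eq_zero_of_pd h.smoothC (fun i => ?_) c, hD⟩
  fin_cases i
  · refine h.xx.trans ?_; rw [hA0, hB]; simp
  · refine h.xy.trans ?_; rw [hA1, hD0]; simp
  · refine h.xp.trans ?_; rw [hA0]; simp
  · refine h.xq.trans ?_; rw [hA3, hB0]; simp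

end KillingSystem

end PlaneWaveKilling

/-! ### Jet functionals at the origin and their values on the explicit fields -/

namespace PlaneWaveKilling

/-- A component at the origin, as a linear functional. -/
def evalCoord (k : Fin 4) : SmoothVectorField R4 →ₗ[ℝ] ℝ where
  toFun X := X.1 0 k
  map_add' _ _ := rfl
  map_smul' _ _ := rfl

/-- A partial derivative of a component at the origin, as a linear functional. -/
noncomputable def derivCoord (i k : Fin 4) : SmoothVectorField R4 →ₗ[ℝ] ℝ where
  toFun X := fderiv ℝ X.1 0 (Pi.single i 1) k
  map_add' X Y := by
    simp [fderiv_add (SmoothVectorField.differentiableAt X 0)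
      (SmoothVectorField.differentiableAt Y 0)]
  map_smul' c X := by
    simp [fderiv_const_smul (SmoothVectorField.differentiableAt X 0)]

/-- Ten linear functionals determining a Killing field of `planeWave f`. -/
noncomputable def jet (f : ℝ → ℝ) : Fin 10 → SmoothVectorField R4 →ₗ[ℝ] ℝ :=
  -- Two entries are corrected to be exactly dual to the flat basis: B_x + f(0) B_p vanishes on
  -- `X10flat`, where B = x̃ - x f(y), and A_x + B_y vanishes on `X8const`, where A_x = 1 and B_y =
  -- -1.
  ![evalCoord 0, evalCoord 2, evalCoord 3, derivCoord 0 3, derivCoord 1 0, evalCoord 1,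
    derivCoord 0 1 + f 0 • derivCoord 2 1, derivCoord 0 0, derivCoord 0 0 + derivCoord 1 1,
    derivCoord 2 1]

theorem jet_apply (f : ℝ → ℝ) (k : Fin 10) (X : SmoothVectorField R4) :
    jet f k X = ![X.1 0 0, X.1 0 2, X.1 0 3, fderiv ℝ X.1 0 (Pi.single 0 1) 3,
      fderiv ℝ X.1 0 (Pi.single 1 1) 0, X.1 0 1,
      fderiv ℝ X.1 0 (Pi.single 0 1) 1 + f 0 * fderiv ℝ X.1 0 (Pi.single 2 1) 1,
      fderiv ℝ X.1 0 (Pi.single 0 1) 0,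
      fderiv ℝ X.1 0 (Pi.single 0 1) 0 + fderiv ℝ X.1 0 (Pi.single 1 1) 1,
      fderiv ℝ X.1 0 (Pi.single 2 1) 1] k := by
  fin_cases k <;> rfl

section Jets

variable {f : ℝ → ℝ}

theorem jet_X1 (k : Fin 10) : jet f k ⟨X1, contDiff_X1⟩ = if k = 0 then 1 else 0 := by
  rw [jet_apply]; fin_cases k <;> simp [fderiv_X1] <;> simp [X1]

theorem jet_X2 (k : Fin 10) : jet f k ⟨X2, contDiff_X2⟩ = if k = 1 then 1 else 0 := by
  rw [jet_apply]; fin_cases k <;> simp [fderiv_X2] <;> simp [X2]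

theorem jet_X3 (k : Fin 10) : jet f k ⟨X3, contDiff_X3⟩ = if k = 2 then 1 else 0 := by
  rw [jet_apply]; fin_cases k <;> simp [fderiv_X3] <;> simp [X3]

theorem jet_X4 (k : Fin 10) : jet f k ⟨X4, contDiff_X4⟩ = if k = 3 then 1 else 0 := by
  rw [jet_apply]; fin_cases k <;> simp [fderiv_X4] <;> simp [X4]

theorem jet_X5 (hf : ContDiff ℝ ∞ f) (k : Fin 10) :
    jet f k ⟨X5 f, contDiff_X5 hf⟩ = if k = 4 then 1 else 0 := by
  rw [jet_apply]; fin_cases k <;> simp [fderiv_X5 hf] <;> simp [X5]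

theorem jet_X6const (hf : ContDiff ℝ ∞ f) (c : ℝ) (k : Fin 10) :
    jet f k ⟨X6const f c, contDiff_X6const hf c⟩ = if k = 5 then 1 else 0 := by
  rw [jet_apply]; fin_cases k <;> simp [fderiv_X6const hf] <;> simp [X6const]

theorem jet_X7const (hf : ContDiff ℝ ∞ f) (c : ℝ) (k : Fin 10) :
    jet f k ⟨X7const f c, contDiff_X7const hf c⟩ = if k = 6 then 1 else 0 := by
  rw [jet_apply]; fin_cases k <;> simp [fderiv_X7const hf] <;> simp [X7const]

theorem jet_X8const (hf : ContDiff ℝ ∞ f) (k : Fin 10) :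
    jet f k ⟨X8const f, contDiff_X8const hf⟩ = if k = 7 then 1 else 0 := by
  rw [jet_apply]; fin_cases k <;> simp [fderiv_X8const hf] <;> simp [X8const]

theorem jet_X9flat (k : Fin 10) :
    jet f k ⟨X9flat f, contDiff_X9flat⟩ = if k = 8 then 1 else 0 := by
  rw [jet_apply]; fin_cases k <;> simp [fderiv_X9flat] <;> simp [X9flat]

theorem jet_X10flat (hf : ContDiff ℝ ∞ f) (k : Fin 10) :
    jet f k ⟨X10flat f, contDiff_X10flat hf⟩ = if k = 9 then 1 else 0 := by
  rw [jet_apply]; fin_cases k <;> simp [fderiv_X10flat hf] <;> simp [X10flat]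

/-- Restricted to the first six functionals because A_x = -l/2 enters entries 7 and 8. -/
theorem jet_X6exp (hf : ContDiff ℝ ∞ f) (a l : ℝ) (i : Fin 6) :
    jet f (i.castLE (by norm_num)) ⟨X6exp f a l, contDiff_X6exp hf a l⟩ =
      if i = 5 then 1 else 0 := by
  rw [jet_apply]; fin_cases i <;> simp [fderiv_X6exp hf] <;> simp [X6exp]

/-- The positions of the jet functionals dual to `X1, …, X5, X6pow`. -/
def powIndex : Fin 6 → Fin 10 := ![0, 1, 2, 3, 4, 7]

/-- Entry 7 is A_x = 1. Entry 5 is skipped: B(0) = -s b is zero when b = 0, so it cannot serve as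
the dual functional. -/
theorem jet_X6pow (hf : ContDiff ℝ ∞ f) (b : ℝ) (n : ℕ) (i : Fin 6) :
    jet f (powIndex i) ⟨X6pow f b n, contDiff_X6pow hf b n⟩ = if i = 5 then 1 else 0 := by
  rw [jet_apply]; fin_cases i <;> simp [powIndex, fderiv_X6pow hf] <;> simp [X6pow]

end Jets

/-! ### Verification that the explicit fields are Killing -/

section Killing

variable {f : ℝ → ℝ} {hf : AnalyticOnNhd ℝ f Set.univ}

theorem isKilling_X1 : (planeWave f hf).IsKilling X1 := by
  intro p u v
  simp [lieDeriv_planeWave, fderiv_X1, X1]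

theorem isKilling_X2 : (planeWave f hf).IsKilling X2 := by
  intro p u v
  simp [lieDeriv_planeWave, fderiv_X2, X2]

theorem isKilling_X3 : (planeWave f hf).IsKilling X3 := by
  intro p u v
  simp [lieDeriv_planeWave, fderiv_X3, X3]

theorem isKilling_X4 : (planeWave f hf).IsKilling X4 := by
  intro p u v
  simp only [lieDeriv_planeWave, fderiv_X4]
  simp [X4]

theorem isKilling_X5 : (planeWave f hf).IsKilling (X5 f) := by
  intro p u v
  simp only [lieDeriv_planeWave, fderiv_X5 (contDiff_of_analytic hf)]
  simp [X5]
  ring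

theorem isKilling_X6const {c : ℝ} (h2 : ∀ y, deriv (deriv f) y = c) :
    (planeWave f hf).IsKilling (X6const f c) := by
  intro p u v
  simp only [lieDeriv_planeWave, fderiv_X6const (contDiff_of_analytic hf), h2]
  simp [X6const]
  ring

theorem isKilling_X7const {c : ℝ} (h2 : ∀ y, deriv (deriv f) y = c) :
    (planeWave f hf).IsKilling (X7const f c) := by
  intro p u v
  simp only [lieDeriv_planeWave, fderiv_X7const (contDiff_of_analytic hf), h2]
  simp [X7const]
  ring

theorem eq_of_deriv_eq {g k : ℝ → ℝ} (h : ∀ y, HasDerivAt g (k y) y) {G : ℝ → ℝ}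
    (hG : ∀ y, HasDerivAt G (k y) y) (y₀ y : ℝ) : g y - G y = g y₀ - G y₀ :=
  is_const_of_deriv_eq_zero (f := fun y => g y - G y)
    (fun y => ((h y).sub (hG y)).differentiableAt)
    (fun y => by rw [((h y).fun_sub (hG y)).deriv, sub_self]) y y₀

theorem hasDerivAt_of_contDiff {g : ℝ → ℝ} (hg : ContDiff ℝ ∞ g) (y : ℝ) :
    HasDerivAt g (deriv g y) y :=
  (hg.differentiable (by simp) y).hasDerivAt

theorem deriv_eq_of_const {c : ℝ} (hf : ContDiff ℝ ∞ f) (h2 : ∀ y, deriv (deriv f) y = c)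
    (y : ℝ) : deriv f y = c * y + deriv f 0 := by
  have := eq_of_deriv_eq (hasDerivAt_of_contDiff (contDiff_deriv hf)) (G := fun y => c * y)
    (fun y => by simpa [h2 y] using (hasDerivAt_id' y).const_mul c) 0 y
  simp at this
  linarith

theorem isKilling_X8const {c : ℝ} (h2 : ∀ y, deriv (deriv f) y = c) :
    (planeWave f hf).IsKilling (X8const f) := by
  intro p u v
  have h1 := deriv_eq_of_const (contDiff_of_analytic hf) h2 (p 1)
  simp only [lieDeriv_planeWave, fderiv_X8const (contDiff_of_analytic hf), h2]
  simp [X8const]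
  rw [h1]
  ring

theorem isKilling_X9flat (h2 : ∀ y, deriv (deriv f) y = 0) :
    (planeWave f hf).IsKilling (X9flat f) := by
  intro p u v
  have h1 := deriv_eq_of_const (contDiff_of_analytic hf) h2 (p 1)
  simp only [lieDeriv_planeWave, fderiv_X9flat]
  simp [X9flat]
  rw [h1]
  ring

theorem isKilling_X10flat (h2 : ∀ y, deriv (deriv f) y = 0) :
    (planeWave f hf).IsKilling (X10flat f) := by
  intro p u v
  have h1 := deriv_eq_of_const (contDiff_of_analytic hf) h2 (p 1)
  simp only [lieDeriv_planeWave, fderiv_X10flat (contDiff_of_analytic hf)]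
  simp [X10flat]
  rw [h1]
  ring

theorem isKilling_X6exp {a l : ℝ} (h2 : ∀ y, deriv (deriv f) y = a * Real.exp (l * y)) :
    (planeWave f hf).IsKilling (X6exp f a l) := by
  intro p u v
  have hc := contDiff_of_analytic hf
  -- Since f''' = l f'', the function f'' - l f' is constant; its value at 0 appears in the ∂_ỹ
  -- component.
  have h1 : deriv (deriv f) (p 1) - l * deriv f (p 1) = a - l * deriv f 0 := by
    have := eq_of_deriv_eq (hasDerivAt_of_contDiff (contDiff_deriv (contDiff_deriv hc)))
      (G := fun y => l * deriv f y) (fun y => by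
        have e := (hasDerivAt_of_contDiff (contDiff_deriv hc) y).const_mul l
        refine e.congr_deriv ?_
        rw [show deriv (deriv f) = fun y => a * Real.exp (l * y) from funext h2]
        have := (((hasDerivAt_id' y).const_mul l).exp).const_mul a
        rw [this.deriv]
        ring) 0 (p 1)
    simp only [h2 0] at this
    simpa using this
  simp only [lieDeriv_planeWave, fderiv_X6exp hc]
  simp [X6exp]
  -- Only the (x, y) component of L_X g is not identically zero; it is x times the constancy
  -- relation.
  linear_combination p 0 * (u 0 * v 1 + u 1 * v 0) * h1

theorem isKilling_X6pow {a b : ℝ} {n : ℕ} (h2 : ∀ y, deriv (deriv f) y = a * (y + b) ^ n) :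
    (planeWave f hf).IsKilling (X6pow f b n) := by
  intro p u v
  have hc := contDiff_of_analytic hf
  -- Both sides vanish at y = -b and have derivative (n + 1) f''; hence the base point -b in the ∂_ỹ
  -- component of `X6pow`.
  have h1 : (p 1 + b) * deriv (deriv f) (p 1) = (n + 1) * (deriv f (p 1) - deriv f (-b)) := by
    have := eq_of_deriv_eq (G := fun y => (n + 1) * deriv f y)
      (g := fun y => a * (y + b) ^ (n + 1))
      (k := fun y => (n + 1) * deriv (deriv f) y)
      (fun y => by
        refine ((((hasDerivAt_id' y).add_const b).pow (n + 1)).const_mul a).congr_deriv ?_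
        rw [h2]; simp; ring)
      (fun y => (hasDerivAt_of_contDiff (contDiff_deriv hc) y).const_mul _) (-b) (p 1)
    simp at this
    rw [h2]
    linear_combination this
  have hn : (n : ℝ) + 2 ≠ 0 := by positivity
  simp only [lieDeriv_planeWave, fderiv_X6pow hc]
  simp [X6pow]
  field_simp
  linear_combination (-2) * p 0 * (u 0 * v 1 + u 1 * v 0) * h1

end Killing

/-! ### Compatibility conditions in terms of jets -/

section Constraints

variable {f : ℝ → ℝ} {hf : AnalyticOnNhd ℝ f Set.univ} {X : SmoothVectorField R4}

/-- Entries 7 and 8 are A_x and A_x + B_y, so B_y is their difference. Entry 6 equals B_x only when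
B_p = 0, which is why the second condition is conditional. -/
theorem jet_killing_constraints (hK : (planeWave f hf).IsKilling X) :
    (∀ y, deriv (deriv f) y * jet f 9 X = 0) ∧
    (jet f 9 X = 0 → ∀ y, deriv (deriv (deriv f)) y * jet f 6 X = 0) ∧
    ∀ y, deriv (deriv (deriv f)) y * (jet f 5 X + (jet f 8 X - jet f 7 X) * y) +
      deriv (deriv f) y * (2 * jet f 8 X) = 0 := by
  have hc := contDiff_of_analytic hf
  have hs := killingSystem_of_isKilling X.2 hK
  have h1 := hs.pB_mul_deriv2 hc
  have h2 := hs.deriv3_mul_xB hc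
  have h3 := hs.deriv3_axis hc
  simp only [pd_coord X.2] at h1 h2 h3
  simp only [jet_apply]
  refine ⟨fun y => h1 y, fun h y => ?_, fun y => ?_⟩
  · have h' : fderiv ℝ X.1 0 (Pi.single 2 1) 1 = 0 := h
    have := h2 h y
    simpa [h'] using this
  · have := h3 y
    simp
    linear_combination this

theorem eq_zero_of_jet (hK : (planeWave f hf).IsKilling X) (h : ∀ k, jet f k X = 0) :
    X = 0 := by
  have hs := killingSystem_of_isKilling X.2 hK
  have h0 := h 0
  have h1 := h 1
  have h2 := h 2
  have h3 := h 3
  have h4 := h 4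
  have h5 := h 5
  have h6 := h 6
  have h7 := h 7
  have h8 := h 8
  have h9 := h 9
  simp [jet_apply] at h0 h1 h2 h3 h4 h5 h6 h7 h8 h9
  simp only [h7, h9, mul_zero, zero_add, add_zero] at h6 h8
  obtain ⟨hA, hB, hC, hD⟩ := hs.eq_zero (contDiff_of_analytic hf) h0 ((pd_coord X.2 _ _ _).trans h7)
    ((pd_coord X.2 _ _ _).trans h4) h5 ((pd_coord X.2 _ _ _).trans h6)
    ((pd_coord X.2 _ _ _).trans h8) ((pd_coord X.2 _ _ _).trans h9) h1 h2
    ((pd_coord X.2 _ _ _).trans h3)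
  apply Subtype.ext
  funext p i
  fin_cases i
  · exact congrFun hA p
  · exact congrFun hB p
  · exact congrFun hC p
  · exact congrFun hD p

end Constraints

/-! ### The Euler and exponential equations -/

section Euler

/-- Differentiating an Euler equation gives an Euler equation of degree one lower. -/
theorem iteratedDeriv_euler (k : ℕ) : ∀ {h : ℝ → ℝ} {b m : ℝ}, ContDiff ℝ ∞ h →
    (∀ y, deriv h y * (y + b) = m * h y) →
    ∀ y, iteratedDeriv (k + 1) h y * (y + b) = (m - k) * iteratedDeriv k h y := by
  induction k with
  | zero => intro h b m _ he y; simpa using he y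
  | succ k ih =>
    intro h b m hh he y
    have h' : ∀ y, deriv (deriv h) y * (y + b) = (m - 1) * deriv h y := fun y => by
      have e1 := (hasDerivAt_of_contDiff (contDiff_deriv hh) y).fun_mul
        ((hasDerivAt_id' y).add_const b)
      rw [show (fun y => deriv h y * (y + b)) = fun y => m * h y from funext he] at e1
      have := e1.unique ((hasDerivAt_of_contDiff hh y).const_mul m)
      linarith
    have := ih (contDiff_deriv hh) h' y
    rw [← iteratedDeriv_succ', ← iteratedDeriv_succ'] at this
    rw [this]
    push_cast; ring

/-- Induction on the degree: h' is a monomial of degree n, and the equation itself then recovers h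
without integration. -/
theorem eq_pow_of_euler (n : ℕ) : ∀ {h : ℝ → ℝ} {b : ℝ}, ContDiff ℝ ∞ h →
    (∀ y, deriv h y * (y + b) = n * h y) → ∃ a : ℝ, ∀ y, h y = a * (y + b) ^ n := by
  induction n with
  | zero =>
    intro h b hh he
    have h0 : ∀ y, deriv h y = 0 := by
      -- The equation says nothing about h' at the singular point -b; continuity supplies its value
      -- there.
      have hd : Set.EqOn (deriv h) (fun _ => 0) {-b}ᶜ := fun y hy => by
        have hy' : y + b ≠ 0 := fun h => hy (eq_neg_of_add_eq_zero_left h)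
        have := he y
        simpa [hy'] using this
      have := Continuous.ext_on (dense_compl_singleton (-b)) (contDiff_deriv hh).continuous
        continuous_const hd
      exact congrFun this
    exact ⟨h 0, fun y => by
      simpa using is_const_of_deriv_eq_zero (hh.differentiable (by simp)) h0 y 0⟩
  | succ n ih =>
    intro h b hh he
    obtain ⟨a, ha⟩ := ih (b := b) (contDiff_deriv hh) fun y => by
      have := iteratedDeriv_euler 1 hh he y
      simp only [iteratedDeriv_succ', iteratedDeriv_zero] at this
      rw [this]; push_cast; ring
    refine ⟨a / (n + 1), fun y => ?_⟩
    have := he y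
    rw [ha] at this
    have hn : (n : ℝ) + 1 ≠ 0 := by positivity
    push_cast at this
    field_simp
    linear_combination -this

/-- At the singular point the differentiated equations read (m - k) h⁽ᵏ⁾(-b) = 0. A nonvanishing
derivative therefore forces m = k; if all vanish, analyticity gives h = 0. Smoothness alone would
allow solutions glued from different multiples on the two sides of -b. -/
theorem exists_eq_pow_of_euler {h : ℝ → ℝ} {b m : ℝ} (hh : AnalyticOnNhd ℝ h Set.univ)
    (he : ∀ y, deriv h y * (y + b) = m * h y) : ∃ (a : ℝ) (n : ℕ), ∀ y, h y = a * (y + b) ^ n := by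
  have hc := contDiff_of_analytic hh
  by_cases hk : ∃ k, iteratedDeriv k h (-b) ≠ 0
  · obtain ⟨k, hk⟩ := hk
    have := iteratedDeriv_euler k hc he (-b)
    simp only [neg_add_cancel, mul_zero, zero_eq_mul, hk, or_false] at this
    obtain rfl : m = k := by linarith
    obtain ⟨a, ha⟩ := eq_pow_of_euler k hc he
    exact ⟨a, k, ha⟩
  · push Not at hk
    refine ⟨0, 0, fun y => ?_⟩
    have ht : analyticOrderAt h (-b) = ⊤ := by
      refine ENat.eq_top_iff_forall_ge.2 fun n => ?_
      exact (natCast_le_analyticOrderAt_iff_iteratedDeriv_eq_zero (hh _ (Set.mem_univ _))).2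
        fun i _ => hk i
    have := hh.eqOn_zero_of_preconnected_of_eventuallyEq_zero isPreconnected_univ
      (Set.mem_univ (-b)) (analyticOrderAt_eq_top.1 ht)
    simpa using this (Set.mem_univ y)

theorem exists_eq_exp {h : ℝ → ℝ} {l : ℝ} (hc : ContDiff ℝ ∞ h)
    (he : ∀ y, deriv h y = l * h y) : ∃ a : ℝ, ∀ y, h y = a * Real.exp (l * y) := by
  refine ⟨h 0, fun y => ?_⟩
  have hd (y : ℝ) : HasDerivAt (fun y => h y * Real.exp (-l * y)) 0 y := by
    refine ((hasDerivAt_of_contDiff hc y).fun_mul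
      (((hasDerivAt_id' y).const_mul (-l)).exp)).congr_deriv ?_
    rw [he]; ring
  have := is_const_of_deriv_eq_zero (fun y => (hd y).differentiableAt)
    (fun y => (hd y).deriv) y 0
  simp at this
  rw [← this, mul_assoc, ← Real.exp_add]
  simp

end Euler

end PlaneWaveKilling

/-! ### The five cases -/

namespace PlaneWaveKilling

variable {f : ℝ → ℝ}

theorem killingBasis_flat (hf : AnalyticOnNhd ℝ f Set.univ) (h2 : ∀ y, deriv (deriv f) y = 0) :
    Module.finrank ℝ (planeWave f hf).killingAlgebra = 10 ∧
      (planeWave f hf).IsKillingBasis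
        ![X1, X2, X3, X4, X5 f, X6const f 0, X7const f 0, X8const f, X9flat f, X10flat f] := by
  have hc := contDiff_of_analytic hf
  refine PseudoRiemannianMetric.isKillingBasis_of_dual _ _ (fun i => ?_) (fun i => ?_) (jet f)
    (fun i j => ?_) fun X hX h => eq_zero_of_jet hX h
  · fin_cases i
    exacts [contDiff_X1, contDiff_X2, contDiff_X3, contDiff_X4, contDiff_X5 hc,
      contDiff_X6const hc 0, contDiff_X7const hc 0, contDiff_X8const hc, contDiff_X9flat,
      contDiff_X10flat hc]
  · fin_cases i
    exacts [isKilling_X1, isKilling_X2, isKilling_X3, isKilling_X4, isKilling_X5,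
      isKilling_X6const h2, isKilling_X7const h2, isKilling_X8const h2, isKilling_X9flat h2,
      isKilling_X10flat h2]
  · fin_cases j
    exacts [jet_X1 i, jet_X2 i, jet_X3 i, jet_X4 i, jet_X5 hc i, jet_X6const hc 0 i,
      jet_X7const hc 0 i, jet_X8const hc i, jet_X9flat i, jet_X10flat hc i]

theorem killingBasis_const (hf : AnalyticOnNhd ℝ f Set.univ) {c : ℝ} (hc0 : c ≠ 0)
    (h2 : ∀ y, deriv (deriv f) y = c) :
    Module.finrank ℝ (planeWave f hf).killingAlgebra = 8 ∧
      (planeWave f hf).IsKillingBasis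
        ![X1, X2, X3, X4, X5 f, X6const f c, X7const f c, X8const f] := by
  have hc := contDiff_of_analytic hf
  have hσ (i : Fin 8) (j : Fin 8) :
      (i.castLE (by norm_num) : Fin 10) = j.castLE (by norm_num) ↔ i = j := Fin.castLE_inj
  refine PseudoRiemannianMetric.isKillingBasis_of_dual _ _ (fun i => ?_) (fun i => ?_)
    (fun i => jet f (i.castLE (by norm_num))) (fun i j => ?_) fun X hX h => ?_
  · fin_cases i
    exacts [contDiff_X1, contDiff_X2, contDiff_X3, contDiff_X4, contDiff_X5 hc,
      contDiff_X6const hc c, contDiff_X7const hc c, contDiff_X8const hc]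
  · fin_cases i
    exacts [isKilling_X1, isKilling_X2, isKilling_X3, isKilling_X4, isKilling_X5,
      isKilling_X6const h2, isKilling_X7const h2, isKilling_X8const h2]
  · simp only [← hσ i j]
    fin_cases j
    exacts [jet_X1 _, jet_X2 _, jet_X3 _, jet_X4 _, jet_X5 hc _, jet_X6const hc c _,
      jet_X7const hc c _, jet_X8const hc _]
  · obtain ⟨e1, -, e3⟩ := jet_killing_constraints hX
    have h3 : ∀ y, deriv (deriv (deriv f)) y = 0 := by
      rw [show deriv (deriv f) = fun _ => c from funext h2]; simp
    have h9 : jet f 9 X = 0 := by simpa [h2, hc0] using e1 0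
    -- With f''' = 0 the affine constraint reduces to 2 c (A_x + B_y) = 0.
    have h8 : jet f 8 X = 0 := by simpa [h2, h3, hc0] using e3 0
    refine eq_zero_of_jet hX fun k => ?_
    fin_cases k
    exacts [h 0, h 1, h 2, h 3, h 4, h 5, h 6, h 7, h8, h9]

theorem killingBasis_exp (hf : AnalyticOnNhd ℝ f Set.univ) {a l : ℝ} (ha : a ≠ 0) (hl : l ≠ 0)
    (h2 : ∀ y, deriv (deriv f) y = a * Real.exp (l * y)) :
    Module.finrank ℝ (planeWave f hf).killingAlgebra = 6 ∧
      (planeWave f hf).IsKillingBasis ![X1, X2, X3, X4, X5 f, X6exp f a l] := by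
  have hc := contDiff_of_analytic hf
  have hσ (i : Fin 6) (j : Fin 6) :
      (i.castLE (by norm_num) : Fin 10) = j.castLE (by norm_num) ↔ i = j := Fin.castLE_inj
  refine PseudoRiemannianMetric.isKillingBasis_of_dual _ _ (fun i => ?_) (fun i => ?_)
    (fun i => jet f (i.castLE (by norm_num))) (fun i j => ?_) fun X hX h => ?_
  · fin_cases i
    exacts [contDiff_X1, contDiff_X2, contDiff_X3, contDiff_X4, contDiff_X5 hc,
      contDiff_X6exp hc a l]
  · fin_cases i
    exacts [isKilling_X1, isKilling_X2, isKilling_X3, isKilling_X4, isKilling_X5,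
      isKilling_X6exp h2]
  · by_cases hj : j = 5
    · subst hj; exact jet_X6exp hc a l i
    · simp only [← hσ i j]
      fin_cases j
      exacts [jet_X1 _, jet_X2 _, jet_X3 _, jet_X4 _, jet_X5 hc _, (hj rfl).elim]
  · obtain ⟨e1, e2, e3⟩ := jet_killing_constraints hX
    have h3 : ∀ y, deriv (deriv (deriv f)) y = a * Real.exp (l * y) * l := fun y => by
      rw [show deriv (deriv f) = fun y => a * Real.exp (l * y) from funext h2]
      rw [((((hasDerivAt_id' y).const_mul l).exp).const_mul a).deriv]
      ring
    have h5 : jet f 5 X = 0 := h 5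
    have h9 : jet f 9 X = 0 := by simpa [h2, ha] using e1 0
    have h6 : jet f 6 X = 0 := by simpa [h3, ha, hl] using e2 h9 0
    -- At y = 0 the slope term drops out, and B(0) = 0; evaluating at y = 1 afterwards isolates the
    -- slope.
    have h8 : jet f 8 X = 0 := by simpa [h2, h3, h5, ha, hl] using e3 0
    have h7 : jet f 7 X = 0 := by simpa [h2, h3, h5, h8, ha, hl] using e3 1
    refine eq_zero_of_jet hX fun k => ?_
    fin_cases k
    exacts [h 0, h 1, h 2, h 3, h 4, h5, h6, h7, h8, h9]

theorem killingBasis_pow (hf : AnalyticOnNhd ℝ f Set.univ) {a b : ℝ} {n : ℕ} (ha : a ≠ 0)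
    (hn : 1 ≤ n) (h2 : ∀ y, deriv (deriv f) y = a * (y + b) ^ n) :
    Module.finrank ℝ (planeWave f hf).killingAlgebra = 6 ∧
      (planeWave f hf).IsKillingBasis ![X1, X2, X3, X4, X5 f, X6pow f b n] := by
  have hc := contDiff_of_analytic hf
  have hσ (i : Fin 6) (j : Fin 6) : powIndex i = powIndex j ↔ i = j := by
    revert i j; decide
  refine PseudoRiemannianMetric.isKillingBasis_of_dual _ _ (fun i => ?_) (fun i => ?_)
    (fun i => jet f (powIndex i)) (fun i j => ?_) fun X hX h => ?_
  · fin_cases i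
    exacts [contDiff_X1, contDiff_X2, contDiff_X3, contDiff_X4, contDiff_X5 hc,
      contDiff_X6pow hc b n]
  · fin_cases i
    exacts [isKilling_X1, isKilling_X2, isKilling_X3, isKilling_X4, isKilling_X5,
      isKilling_X6pow h2]
  · by_cases hj : j = 5
    · subst hj; exact jet_X6pow hc b n i
    · simp only [← hσ i j]
      fin_cases j
      exacts [jet_X1 _, jet_X2 _, jet_X3 _, jet_X4 _, jet_X5 hc _, (hj rfl).elim]
  · obtain ⟨e1, e2, e3⟩ := jet_killing_constraints hX
    obtain ⟨m, rfl⟩ : ∃ m, n = m + 1 := ⟨n - 1, by omega⟩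
    have h3 : ∀ y, deriv (deriv (deriv f)) y = a * ((m + 1) * (y + b) ^ m) := fun y => by
      rw [show deriv (deriv f) = fun y => a * (y + b) ^ (m + 1) from funext h2]
      rw [((((hasDerivAt_id' y).add_const b).fun_pow (m + 1)).const_mul a).deriv]
      simp
    have hm : (m : ℝ) + 1 ≠ 0 := by positivity
    have h7 : jet f 7 X = 0 := h 5
    have h9 : jet f 9 X = 0 := by simpa [h2, ha] using e1 (1 - b)
    have h6 : jet f 6 X = 0 := by simpa [h3, ha, hm] using e2 h9 (1 - b)
    -- At y = 1 - b and y = 2 - b the base y + b is 1 and 2, so the powers can be divided out. The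
    -- two relations differ by (m + 3) times entry 8.
    have k1 : (m + 1) * (jet f 5 X + jet f 8 X * (1 - b)) + 2 * jet f 8 X = 0 := by
      have := e3 (1 - b)
      simp only [h2, h3, h7, sub_add_cancel, one_pow] at this
      apply mul_left_cancel₀ ha
      linear_combination this
    have k2 : (m + 1) * (jet f 5 X + jet f 8 X * (2 - b)) + 4 * jet f 8 X = 0 := by
      have := e3 (2 - b)
      simp only [h2, h3, h7, sub_add_cancel] at this
      apply mul_left_cancel₀ (mul_ne_zero ha (pow_ne_zero m (two_ne_zero (α := ℝ))))
      linear_combination this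
    have h8 : jet f 8 X = 0 := by
      have hm' : (m : ℝ) + 3 ≠ 0 := by positivity
      apply mul_left_cancel₀ hm'
      linear_combination k2 - k1
    have h5 : jet f 5 X = 0 := by simpa [h8, hm] using k1
    refine eq_zero_of_jet hX fun k => ?_
    fin_cases k
    exacts [h 0, h 1, h 2, h 3, h 4, h5, h6, h7, h8, h9]

theorem killingBasis_generic (hf : AnalyticOnNhd ℝ f Set.univ)
    (hexp : ¬ ∃ a l : ℝ, ∀ y, deriv (deriv f) y = a * Real.exp (l * y))
    (hpow : ¬ ∃ (a b : ℝ) (n : ℕ), ∀ y, deriv (deriv f) y = a * (y + b) ^ n) :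
    Module.finrank ℝ (planeWave f hf).killingAlgebra = 5 ∧
      (planeWave f hf).IsKillingBasis ![X1, X2, X3, X4, X5 f] := by
  have hc := contDiff_of_analytic hf
  have hc2 := contDiff_deriv (contDiff_deriv hc)
  have hσ (i : Fin 5) (j : Fin 5) :
      (i.castLE (by norm_num) : Fin 10) = j.castLE (by norm_num) ↔ i = j := Fin.castLE_inj
  refine PseudoRiemannianMetric.isKillingBasis_of_dual _ _ (fun i => ?_) (fun i => ?_)
    (fun i => jet f (i.castLE (by norm_num))) (fun i j => ?_) fun X hX h => ?_
  · fin_cases i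
    exacts [contDiff_X1, contDiff_X2, contDiff_X3, contDiff_X4, contDiff_X5 hc]
  · fin_cases i
    exacts [isKilling_X1, isKilling_X2, isKilling_X3, isKilling_X4, isKilling_X5]
  · simp only [← hσ i j]
    fin_cases j
    exacts [jet_X1 _, jet_X2 _, jet_X3 _, jet_X4 _, jet_X5 hc _]
  · obtain ⟨e1, e2, e3⟩ := jet_killing_constraints hX
    obtain ⟨y₂, hy₂⟩ : ∃ y, deriv (deriv f) y ≠ 0 := by
      by_contra! hcon
      exact hexp ⟨0, 0, by simpa using hcon⟩
    obtain ⟨y₃, hy₃⟩ : ∃ y, deriv (deriv (deriv f)) y ≠ 0 := by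
      by_contra! hcon
      obtain ⟨a, ha⟩ := exists_eq_exp (l := 0) hc2 (by simpa using hcon)
      exact hexp ⟨a, 0, ha⟩
    have h9 : jet f 9 X = 0 := by simpa [hy₂] using e1 y₂
    have h6 : jet f 6 X = 0 := by simpa [hy₃] using e2 h9 y₃
    -- A nonzero slope B_y would make the constraint an Euler equation centred at -B(0)/B_y, so f''
    -- would be a power.
    have h78 : jet f 8 X - jet f 7 X = 0 := by
      by_contra hne
      obtain ⟨a, n, ha⟩ := exists_eq_pow_of_euler (h := deriv (deriv f))
        (b := jet f 5 X / (jet f 8 X - jet f 7 X))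
        (m := -(2 * jet f 8 X) / (jet f 8 X - jet f 7 X)) hf.deriv.deriv fun y => by
          have := e3 y
          field_simp
          linear_combination this
      exact hpow ⟨a, _, n, ha⟩
    -- With slope zero but B(0) ≠ 0, the constraint is f''' = const · f'', so f'' would be an
    -- exponential.
    have h5 : jet f 5 X = 0 := by
      by_contra hne
      obtain ⟨a, ha⟩ := exists_eq_exp (l := -(2 * jet f 8 X) / jet f 5 X) hc2 fun y => by
        have := e3 y
        rw [h78] at this
        field_simp
        linear_combination this
      exact hexp ⟨a, _, ha⟩
    have h8 : jet f 8 X = 0 := by simpa [h78, h5, hy₂] using e3 y₂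
    have h7 : jet f 7 X = 0 := by simpa [h8] using h78
    refine eq_zero_of_jet hX fun k => ?_
    fin_cases k
    exacts [h 0, h 1, h 2, h 3, h 4, h5, h6, h7, h8, h9]

end PlaneWaveKilling

theorem theorem1p11 (f : ℝ → ℝ) (hf : AnalyticOnNhd ℝ f Set.univ) :
    -- `f'' = 0`
    ((∀ y, iteratedDeriv 2 f y = 0) →
      Module.finrank ℝ (planeWave f hf).killingAlgebra = 10 ∧
      (planeWave f hf).IsKillingBasis
        ![X1, X2, X3, X4, X5 f, X6const f 0, X7const f 0, X8const f, X9flat f, X10flat f]) ∧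
    -- `f'' = c ≠ 0`
    (∀ c : ℝ, c ≠ 0 → (∀ y, iteratedDeriv 2 f y = c) →
      Module.finrank ℝ (planeWave f hf).killingAlgebra = 8 ∧
      (planeWave f hf).IsKillingBasis
        ![X1, X2, X3, X4, X5 f, X6const f c, X7const f c, X8const f]) ∧
    -- `f'' = a e^{l y}` with `a ≠ 0`, `l ≠ 0`
    (∀ a l : ℝ, a ≠ 0 → l ≠ 0 → (∀ y, iteratedDeriv 2 f y = a * Real.exp (l * y)) →
      Module.finrank ℝ (planeWave f hf).killingAlgebra = 6 ∧
      (planeWave f hf).IsKillingBasis ![X1, X2, X3, X4, X5 f, X6exp f a l]) ∧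
    -- `f'' = a (y + b)^n` with `a ≠ 0`, `n ≥ 1`
    (∀ (a b : ℝ) (n : ℕ), a ≠ 0 → 1 ≤ n → (∀ y, iteratedDeriv 2 f y = a * (y + b) ^ n) →
      Module.finrank ℝ (planeWave f hf).killingAlgebra = 6 ∧
      (planeWave f hf).IsKillingBasis ![X1, X2, X3, X4, X5 f, X6pow f b n]) ∧
    -- `f''` is of none of the forms `a e^{l y}`, `a (y + b)^n`
    ((¬ ∃ a l : ℝ, ∀ y, iteratedDeriv 2 f y = a * Real.exp (l * y)) →
      (¬ ∃ (a b : ℝ) (n : ℕ), ∀ y, iteratedDeriv 2 f y = a * (y + b) ^ n) →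
      Module.finrank ℝ (planeWave f hf).killingAlgebra = 5 ∧
      (planeWave f hf).IsKillingBasis ![X1, X2, X3, X4, X5 f]) := by
  rw [show iteratedDeriv 2 f = deriv (deriv f) by simp [iteratedDeriv_succ]]
  exact ⟨killingBasis_flat hf, fun _ => killingBasis_const hf, fun _ _ => killingBasis_exp hf,
    fun _ _ _ => killingBasis_pow hf, killingBasis_generic hf⟩
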